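/- Let $X$ be a non-empty compact metric space and $f\colon X\to X$ a continuous map with $h_{\rm top}(f)<+\infty$. Let $C(X)$ be the space of continuous functions $X\to\mathbb R$, $\mathcal P(X)$ the set of Borel probability measures on $X$ with the weak$^*$ topology, $\mathcal P_f(X)\subset\mathcal P(X)$ the subspace of $f$-invariant ones, and $h_\mu(f)$ the Kolmogorov–Sinai entropy of $\mu\in\mathcal P_f(X)$. For $\varphi\in C(X)$ let $$P_{\rm top}(f,\varphi)=\lim_{\varepsilon\to0^+}\limsup_{n\to\infty}\frac1n\log\sup_E\sum_{x\in E}e^{\varphi(x)+\varphi(f(x))+\dots+\varphi(f^n(x))},$$ where the supremum is over the sets $E\subset X$ such that $\max_{0\le i\le n}d(f^i(x),f^i(z))\ge\varepsilon$ for all distinct $x,z\in E$. For $\mu\in\mathcal P(X)$ put $$\mathfrak h_\mu(f)=\inf_{\varphi\in C(X)}\Big\{P_{\rm top}(f,\varphi)-\int\varphi\,d\mu\Big\}.$$ Then $\mu\mapsto\mathfrak h_\mu(f)$ is an upper semi-continuous map $\mathcal P(X)\to[-\infty,+\infty)$, and: (a) $0\le h_\mu(f)\le\mathfrak h_\mu(f)$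 for every $\mu\in\mathcal P_f(X)$; in particular $\mathfrak h_\mu(f)$ is finite on $\mathcal P_f(X)$. (b) For every $\varphi\in C(X)$, $$P_{\rm top}(f,\varphi)=\max_{\mu\in\mathcal P(X)}\Big\{\mathfrak h_\mu(f)+\int\varphi\,d\mu\Big\}=\max_{\mu\in\mathcal P_f(X)}\Big\{\mathfrak h_\mu(f)+\int\varphi\,d\mu\Big\},$$ both maxima being attained. (c) For every $\varphi\in C(X)$, every $\mu\in\mathcal P(X)$ which attains the maximum over $\mathcal P(X)$ in (b) is $f$-invariant. (d) The restriction of $\mathfrak h$ to $\mathcal P_f(X)$ is the upper semi-continuous concave envelope of the Kolmogorov–Sinai entropy: for every $\mu\in\mathcal P_f(X)$, $$\mathfrak h_\mu(f)=\inf\big\{T(\mu)\;:\;T\colon\mathcal P_f(X)\to\mathbb R\text{ continuous and affine},\ T(\nu)\ge h_\nu(f)\ \ \forall\nu\in\mathcal P_f(X)\big\}.$$ -/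

import Mathlib

open MeasureTheory Filter Topology Set
open scoped ENNReal

noncomputable section

namespace ThermoFormalism

/-! ### Topological pressure -/

section Pressure

/-- The dynamical distance `d_n(x, z) = max {d(f^i x, f^i z) : 0 ≤ i ≤ n}`. -/
def dynDist {X : Type*} [MetricSpace X] (f : X → X) (n : ℕ) (x z : X) : ℝ :=
  (Finset.range (n + 1)).sup' Finset.nonempty_range_add_one
    (fun i => dist (f^[i] x) (f^[i] z))

/-- A set `E` is `(n, ε)`-separated if `d_n(x, z) ≥ ε` for all distinct `x, z ∈ E`. -/
def IsSeparatedSet {X : Type*} [MetricSpace X] (f : X → X) (n : ℕ) (ε : ℝ) (E : Set X) : Prop :=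
  E.Pairwise fun x z => ε ≤ dynDist f n x z

/-- `P_n(f, φ, ε)`: the supremum over the `(n, ε)`-separated sets `E` of the sums
`∑_{x ∈ E} exp (φ(x) + φ(f x) + ⋯ + φ(f^n x))`. Finite sets suffice: every subset of a separated
set is separated (and in a compact space all separated sets are finite). -/
def partitionSum {X : Type*} [MetricSpace X] (f : X → X) (φ : X → ℝ) (n : ℕ) (ε : ℝ) : ℝ≥0∞ :=
  ⨆ (E : Finset X) (_ : IsSeparatedSet f n ε (E : Set X)),
    ∑ x ∈ E, ENNReal.ofReal (Real.exp (birkhoffSum f φ (n + 1) x))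

/-- The exponential growth rate `limsup_n (1/n) log P_n(f, φ, ε)` at scale `ε`. -/
def pressureAtScale {X : Type*} [MetricSpace X] (f : X → X) (φ : X → ℝ) (ε : ℝ) : EReal :=
  limsup (fun n : ℕ => ENNReal.log (partitionSum f φ n ε) / (n : EReal)) atTop

/-- The topological pressure `P_top(f, φ) = lim_{ε → 0+} limsup_n (1/n) log P_n(f, φ, ε)`.
The quantity increases as `ε` decreases, so the limit is the supremum over `ε > 0`
(see `tendsto_pressureAtScale`). -/
def topPressure {X : Type*} [MetricSpace X] (f : X → X) (φ : X → ℝ) : EReal :=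
  ⨆ (ε : ℝ) (_ : 0 < ε), pressureAtScale f φ ε

theorem pressureAtScale_antitone {X : Type*} [MetricSpace X] (f : X → X) (φ : X → ℝ) :
    Antitone (pressureAtScale f φ) := by
  intro ε δ h
  refine limsup_le_limsup (Eventually.of_forall fun n => ?_)
  refine EReal.div_le_div_right_of_nonneg (by positivity) (ENNReal.log_monotone ?_)
  exact iSup_mono fun E => iSup_mono' fun hE =>
    ⟨fun x hx z hz hxz => h.trans (hE hx hz hxz), le_rfl⟩

/-- The topological pressure is the limit, as `ε → 0+`, of the pressures at scale `ε`. -/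
theorem tendsto_pressureAtScale {X : Type*} [MetricSpace X] (f : X → X) (φ : X → ℝ) :
    Tendsto (pressureAtScale f φ) (𝓝[>] 0) (𝓝 (topPressure f φ)) := by
  have h := (pressureAtScale_antitone f φ).tendsto_nhdsGT (0 : ℝ)
  rwa [sSup_image] at h

end Pressure

/-! ### Invariant measures and Kolmogorov–Sinai entropy -/

section MetricEntropy

/-- `P_f(X)`: the `f`-invariant Borel probability measures, as a subset of the space of all Borel
probability measures with the weak* topology. -/
def invariantMeasures {X : Type*} [MeasurableSpace X] (f : X → X) : Set (ProbabilityMeasure X) :=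
  {μ | MeasurePreserving f (μ : Measure X) (μ : Measure X)}

/-- The Shannon entropy `H_μ(ξ) = -∑_a μ(ξ = a) log μ(ξ = a)` of the finite partition
`{ξ⁻¹(a)}_a` given by a map `ξ` into a finite type. -/
def partitionEntropy {X : Type*} [MeasurableSpace X] {A : Type*} [Fintype A]
    (μ : Measure X) (ξ : X → A) : ℝ :=
  ∑ a : A, Real.negMulLog (μ.real (ξ ⁻¹' {a}))

/-- The join `ξ ∨ f⁻¹ξ ∨ ⋯ ∨ f^{-(n-1)}ξ`, as the map recording the itinerary of length `n`. -/
def itinerary {X : Type*} {A : Type*} (f : X → X) (ξ : X → A) (n : ℕ) (x : X) : Fin n → A :=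
  fun i => ξ (f^[i] x)

/-- The entropy `h_μ(f, ξ) = lim_n (1/n) H_μ(ξ ∨ f⁻¹ξ ∨ ⋯ ∨ f^{-(n-1)}ξ)` of `f` relative to the
partition `ξ` (for an invariant measure the limit exists). -/
def entropyOfPartition {X : Type*} [MeasurableSpace X] {A : Type*} [Fintype A]
    (f : X → X) (μ : Measure X) (ξ : X → A) : EReal :=
  limsup (fun n : ℕ => ((partitionEntropy μ (itinerary f ξ n) / n : ℝ) : EReal)) atTop

/-- The Kolmogorov–Sinai metric entropy `h_μ(f)`: the supremum of `h_μ(f, ξ)` over all finite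
measurable partitions `ξ`. -/
def metricEntropy {X : Type*} [MeasurableSpace X] (f : X → X) (μ : Measure X) : EReal :=
  ⨆ (k : ℕ) (ξ : X → Fin k) (_ : Measurable ξ), entropyOfPartition f μ ξ

end MetricEntropy

/-! ### The entropy-like map and the concave envelope -/

section Envelope

/-- `𝔥_μ(f) = inf {P_top(f, φ) - ∫ φ dμ : φ ∈ C(X)}`, with values in the extended reals. -/
def hEntropy {X : Type*} [MetricSpace X] [MeasurableSpace X]
    (f : X → X) (μ : ProbabilityMeasure X) : EReal :=
  ⨅ φ : C(X, ℝ), topPressure f φ - ((∫ x, φ x ∂(μ : Measure X) : ℝ) : EReal)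

/-- A real function `T` on a set `K` of probability measures is affine if
`T(pμ + (1-p)ν) = p T(μ) + (1-p) T(ν)` whenever `μ`, `ν` and `ρ = pμ + (1-p)ν` lie in `K`,
`0 ≤ p ≤ 1`. -/
def IsAffineOnMeasures {X : Type*} [MeasurableSpace X] {K : Set (ProbabilityMeasure X)}
    (T : K → ℝ) : Prop :=
  ∀ (μ ν ρ : K) (p : ℝ), 0 ≤ p → p ≤ 1 →
    (ρ.1 : Measure X) =
      ENNReal.ofReal p • (μ.1 : Measure X) + ENNReal.ofReal (1 - p) • (ν.1 : Measure X) →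
    T ρ = p * T μ + (1 - p) * T ν

/-- The upper semi-continuous concave envelope `h**` of the metric entropy on `P_f(X)`: the pointwise
infimum of all continuous affine `T : P_f(X) → ℝ` with `T(ν) ≥ h_ν(f)` for all `ν ∈ P_f(X)`. -/
def entropyEnvelope {X : Type*} [MetricSpace X] [MeasurableSpace X] [BorelSpace X]
    (f : X → X) (μ : invariantMeasures f) : EReal :=
  ⨅ (T : invariantMeasures f → ℝ) (_ : Continuous T ∧ IsAffineOnMeasures T ∧
      ∀ ν : invariantMeasures f, metricEntropy f (ν.1 : Measure X) ≤ (T ν : EReal)),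
    (T μ : EReal)

end Envelope

end ThermoFormalism

end

/-! The core is the variational principle: the pressure of `φ` is the supremum of `h_μ(f) + ∫ φ dμ`
over invariant `μ`. Everything else is duality.

Upper bound (`metricEntropy_add_integral_le_topPressure`): a maximal separated set shadows every
orbit. Gibbs' inequality compares the distribution of itineraries with a mixture of product weights,
one for each shadowing point, that guess the itinerary of `x` from that point. Allowing wrong
guesses with a small weight `θ` gives the bound with no multiplicative loss, so no passage to powers
of `f` is needed.

Lower bound (`exists_le_metricEntropy_add_integral`): nearly optimal separated sets carry Gibbs
weights, and a weak* limit of their orbit averages is invariant. A small partition with null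
boundary distinguishes the separated points, so the partition function is bounded by block weights
(`mul_log_sum_exp_le`), and this bound passes to the limit.

When the topological entropy is finite, so is every pressure, and `𝔥` is an infimum of continuous
functions, hence upper semi-continuous. It lies above the metric entropy and attains its maximum on
the compact set of invariant measures; by the variational principle this maximum is the pressure. A
maximising measure is invariant because adding a coboundary to `φ` does not raise the pressure. For
the envelope, each `P(φ) - ∫ φ dμ` is an admissible affine function; conversely Hahn–Banach replaces
any admissible affine function, almost tightly at a given point, by the integral of a continuous
function. -/

namespace ThermoFormalism

/-! ### Gibbs' inequality and counting of itineraries by blocks -/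

section Counting

/-- Gibbs' inequality with unnormalised weights. -/
theorem sum_negMulLog_le_sum_mul_neg_log_add_log {ι : Type*} {s : Finset ι} {p q : ι → ℝ}
    (hp : ∀ i ∈ s, 0 ≤ p i) (hp1 : ∑ i ∈ s, p i = 1) (hq : ∀ i ∈ s, 0 < q i) :
    ∑ i ∈ s, Real.negMulLog (p i) ≤ ∑ i ∈ s, p i * -Real.log (q i) + Real.log (∑ i ∈ s, q i) := by
  have hs : s.Nonempty := by
    rw [Finset.nonempty_iff_ne_empty]
    rintro rfl
    simp at hp1
  set Q := ∑ i ∈ s, q i with hQ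
  have hQ0 : 0 < Q := Finset.sum_pos hq hs
  have key : ∀ i ∈ s, Real.negMulLog (p i) + p i * Real.log (q i) - p i * Real.log Q
      ≤ q i / Q - p i := by
    intro i hi
    rcases (hp i hi).eq_or_lt with h | h
    · rw [← h]
      simpa using (div_pos (hq i hi) hQ0).le
    · have h1 := Real.log_le_sub_one_of_pos (div_pos (hq i hi) (mul_pos h hQ0))
      rw [Real.log_div (hq i hi).ne' (mul_pos h hQ0).ne', Real.log_mul h.ne' hQ0.ne'] at h1
      have h2 := mul_le_mul_of_nonneg_left h1 h.le
      have h3 : p i * (q i / (p i * Q) - 1) = q i / Q - p i := by field_simp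
      rw [h3] at h2
      rw [Real.negMulLog]
      linarith
  have h := Finset.sum_le_sum key
  rw [Finset.sum_sub_distrib, Finset.sum_sub_distrib, Finset.sum_add_distrib, ← Finset.sum_div,
    ← Finset.sum_mul, hp1, ← hQ, div_self hQ0.ne'] at h
  simp only [mul_neg, Finset.sum_neg_distrib]
  linarith

theorem itinerary_eq_iff {X A : Type*} {f : X → X} {ξ : X → A} {n : ℕ} {x y : X} :
    itinerary f ξ n x = itinerary f ξ n y ↔ ∀ i < n, ξ (f^[i] x) = ξ (f^[i] y) := by
  rw [funext_iff, Fin.forall_iff]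
  rfl

theorem itinerary_add_eq_iff {X A : Type*} {f : X → X} {ξ : X → A} {q n : ℕ} {x y : X} :
    itinerary f ξ (q + n) x = itinerary f ξ (q + n) y ↔
      itinerary f ξ q x = itinerary f ξ q y ∧
        itinerary f ξ n (f^[q] x) = itinerary f ξ n (f^[q] y) := by
  simp only [itinerary_eq_iff, ← Function.iterate_add_apply]
  refine ⟨fun h => ⟨fun i hi => h i (by omega), fun i hi => h _ (by omega)⟩, fun h i hi => ?_⟩
  rcases lt_or_ge i q with h1 | h1
  · exact h.1 i h1
  · obtain ⟨j, rfl⟩ := Nat.exists_eq_add_of_le h1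
    rw [add_comm]
    exact h.2 j (by omega)

/-- Group `F` by the first `q` symbols. On each group `f^[q]` is injective and its image is still
distinguished by the remaining `n` symbols, so `hG` applies. This peels one block off an itinerary.
-/
theorem sum_mul_comp_iterate_le {X A : Type*} [Fintype A] {f : X → X} {ξ : X → A} {q n : ℕ}
    {v : (Fin q → A) → ℝ} (hv : ∀ b, 0 ≤ v b) {G : X → ℝ} {C : ℝ}
    (hG : ∀ F : Finset X, InjOn (itinerary f ξ n) F → ∑ y ∈ F, G y ≤ C)
    (F : Finset X) (hF : InjOn (itinerary f ξ (q + n)) F) :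
    ∑ y ∈ F, v (itinerary f ξ q y) * G (f^[q] y) ≤ (∑ b, v b) * C := by
  classical
  rw [← Finset.sum_fiberwise F (itinerary f ξ q), Finset.sum_mul]
  refine Finset.sum_le_sum fun b _ => ?_
  have h1 : ∑ y ∈ F with itinerary f ξ q y = b, v (itinerary f ξ q y) * G (f^[q] y)
      = v b * ∑ y ∈ F with itinerary f ξ q y = b, G (f^[q] y) := by
    rw [Finset.mul_sum]
    refine Finset.sum_congr rfl fun y hy => ?_
    rw [(Finset.mem_filter.1 hy).2]
  have hinj : ∀ x ∈ F.filter (itinerary f ξ q · = b), ∀ y ∈ F.filter (itinerary f ξ q · = b),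
      itinerary f ξ n (f^[q] x) = itinerary f ξ n (f^[q] y) → x = y := by
    intro x hx y hy hxy
    rw [Finset.mem_filter] at hx hy
    exact hF hx.1 hy.1 (itinerary_add_eq_iff.2 ⟨hx.2.trans hy.2.symm, hxy⟩)
  rw [h1]
  refine mul_le_mul_of_nonneg_left ?_ (hv b)
  rw [← Finset.sum_image (f := G) fun x hx y hy hxy => hinj x hx y hy (by rw [hxy])]
  refine hG _ fun z hz w hw hzw => ?_
  simp only [Finset.coe_image, mem_image, Finset.mem_coe] at hz hw
  obtain ⟨x, hx, rfl⟩ := hz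
  obtain ⟨y, hy, rfl⟩ := hw
  rw [hinj x hx y hy hzw]

/-- The product of the `v`-weights of `m` consecutive blocks is the mass of a word under a product
of subprobabilities, hence sums to at most one; the `s` leftover symbols are counted trivially. -/
theorem sum_prod_blocks_le {X A : Type*} [Fintype A] {f : X → X} {ξ : X → A} {q : ℕ}
    {v : (Fin q → A) → ℝ} (hv : ∀ b, 0 ≤ v b) (hv1 : ∑ b, v b ≤ 1) (m s : ℕ)
    (F : Finset X) (hF : InjOn (itinerary f ξ (m * q + s)) F) :
    ∑ y ∈ F, ∏ r ∈ Finset.range m, v (itinerary f ξ q (f^[r * q] y)) ≤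
      (Fintype.card A : ℝ) ^ s := by
  induction m generalizing F with
  | zero =>
    classical
    simp only [Finset.range_zero, Finset.prod_empty, Finset.sum_const, nsmul_eq_mul, mul_one]
    rw [zero_mul, zero_add] at hF
    have := Finset.card_le_card_of_injOn (t := Finset.univ) _ (fun _ _ => Finset.mem_univ _) hF
    rw [Finset.card_univ, Fintype.card_fun, Fintype.card_fin] at this
    exact_mod_cast this
  | succ m ih =>
    have hF' : InjOn (itinerary f ξ (q + (m * q + s))) F := by
      rwa [show q + (m * q + s) = (m + 1) * q + s by ring]
    have h := sum_mul_comp_iterate_le hv ih F hF'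
    refine le_trans (Eq.le (Finset.sum_congr rfl fun y _ => ?_))
      (h.trans (mul_le_of_le_one_left (by positivity) hv1))
    rw [Finset.prod_range_succ', mul_comm]
    simp only [zero_mul, Function.iterate_zero, id, ← Function.iterate_add_apply, add_mul, one_mul]

/-- The `j` symbols before the first block are also counted trivially, by peeling them off with
constant weight one. -/
theorem sum_prod_blocks_offset_le {X A : Type*} [Fintype A] {f : X → X} {ξ : X → A} {q : ℕ}
    {v : (Fin q → A) → ℝ} (hv : ∀ b, 0 ≤ v b) (hv1 : ∑ b, v b ≤ 1) (j m s : ℕ)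
    (F : Finset X) (hF : InjOn (itinerary f ξ (j + (m * q + s))) F) :
    ∑ y ∈ F, ∏ r ∈ Finset.range m, v (itinerary f ξ q (f^[j + r * q] y)) ≤
      (Fintype.card A : ℝ) ^ (j + s) := by
  have h := sum_mul_comp_iterate_le (v := fun _ => 1) (fun _ => zero_le_one)
    (fun F hF => sum_prod_blocks_le hv hv1 m s F hF) F hF
  simp only [one_mul, Finset.sum_const, Finset.card_univ, Fintype.card_fun, Fintype.card_fin,
    nsmul_eq_mul, mul_one, ← Function.iterate_add_apply] at h
  rw [pow_add]
  convert h using 5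
  · rw [add_comm]
  · push_cast; rfl

/-- By uniqueness of Euclidean division the block starts `j + r * q` are distinct over all offsets
`j < q`, and all lie below `N`. -/
theorem sum_blocks_le_sum_range {w : ℕ → ℝ} (hw : ∀ i, 0 ≤ w i) {q : ℕ} (N : ℕ) :
    ∑ j ∈ Finset.range q, ∑ r ∈ Finset.range ((N - j) / q), w (j + r * q) ≤
      ∑ i ∈ Finset.range N, w i := by
  rw [Finset.sum_sigma']
  rw [← Finset.sum_image (s := (Finset.range q).sigma fun j => Finset.range ((N - j) / q))
    (g := fun x => x.1 + x.2 * q) (f := w)]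
  · refine Finset.sum_le_sum_of_subset_of_nonneg (fun i hi => ?_) fun i _ _ => hw i
    simp only [Finset.mem_image, Finset.mem_sigma, Finset.mem_range] at hi ⊢
    obtain ⟨⟨j, r⟩, ⟨hj, hr⟩, rfl⟩ := hi
    dsimp only at hj hr ⊢
    have h1 : (r + 1) * q ≤ N - j := (Nat.le_div_iff_mul_le (by omega)).1 hr
    rw [add_mul] at h1
    omega
  · rintro ⟨j, r⟩ h ⟨j', r'⟩ h' e
    simp only [Finset.coe_sigma, Set.mem_sigma_iff, Finset.mem_coe, Finset.mem_range] at h h'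
    dsimp only at e
    have hj : j = j' := by
      have := congrArg (· % q) e
      simpa [Nat.mod_eq_of_lt h.1, Nat.mod_eq_of_lt h'.1] using this
    subst hj
    have : r = r' := Nat.eq_of_mul_eq_mul_right (by omega : 0 < q) (by omega)
    subst this
    rfl

/-- The finite-time estimate in the proof of the variational principle: the logarithm of the
partition function of a set of points distinguished by their itineraries is controlled by the
averages, along the orbits, of a weight on blocks of length `q`. -/
theorem mul_log_sum_exp_le {X A : Type*} [Fintype A] [Nonempty A] {f : X → X} {ξ : X → A} {q : ℕ}
    {v : (Fin q → A) → ℝ} (hv : ∀ b, 0 < v b) (hv1 : ∑ b, v b = 1) {N : ℕ} (hqN : q ≤ N)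
    {E : Finset X} (hE : E.Nonempty) (hEinj : InjOn (itinerary f ξ N) E) (S : X → ℝ) :
    q * (Real.log (∑ y ∈ E, Real.exp (S y)) -
        ∑ y ∈ E, Real.exp (S y) / (∑ z ∈ E, Real.exp (S z)) * S y) ≤
      ∑ y ∈ E, Real.exp (S y) / (∑ z ∈ E, Real.exp (S z)) *
        ∑ i ∈ Finset.range N, -Real.log (v (itinerary f ξ q (f^[i] y))) +
      q * (2 * q * Real.log (Fintype.card A)) := by
  set Z := ∑ z ∈ E, Real.exp (S z) with hZ
  have hZ0 : 0 < Z := Finset.sum_pos (fun _ _ => Real.exp_pos _) hE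
  set p : X → ℝ := fun y => Real.exp (S y) / Z with hp
  have hp0 : ∀ y, 0 < p y := fun y => div_pos (Real.exp_pos _) hZ0
  have hp1 : ∑ y ∈ E, p y = 1 := by
    rw [← Finset.sum_div, ← hZ, div_self hZ0.ne']
  -- Gibbs weights give equality in Gibbs' inequality: their entropy is exactly `log Z` minus the
  -- mean of `S`.
  have hneg : ∑ y ∈ E, Real.negMulLog (p y) = Real.log Z - ∑ y ∈ E, p y * S y := by
    have : ∀ y ∈ E, Real.negMulLog (p y) = p y * Real.log Z - p y * S y := by
      intro y _
      rw [Real.negMulLog, hp]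
      dsimp only
      rw [Real.log_div (Real.exp_pos _).ne' hZ0.ne', Real.log_exp]
      ring
    rw [Finset.sum_congr rfl this, Finset.sum_sub_distrib, ← Finset.sum_mul, hp1, one_mul]
  have hvle : ∀ b, v b ≤ 1 := fun b =>
    hv1 ▸ Finset.single_le_sum (fun b _ => (hv b).le) (Finset.mem_univ b)
  have hcard : (1 : ℝ) ≤ Fintype.card A := by exact_mod_cast Fintype.card_pos
  set w : X → ℝ := fun y => -Real.log (v (itinerary f ξ q y)) with hw
  have hw0 : ∀ y, 0 ≤ w y := fun y => by
    rw [hw]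
    exact neg_nonneg.2 (Real.log_nonpos (hv _).le (hvle _))
  -- For each offset `j`, cut the itinerary into blocks of length `q` starting at time `j` and
  -- compare `p` with the product of the block weights.
  have key : ∀ j ∈ Finset.range q, Real.log Z - ∑ y ∈ E, p y * S y ≤
      ∑ y ∈ E, p y * ∑ r ∈ Finset.range ((N - j) / q), w (f^[j + r * q] y) +
        2 * q * Real.log (Fintype.card A) := by
    intro j hj
    have hj := Finset.mem_range.1 hj
    set m := (N - j) / q with hm
    set u : X → ℝ := fun y => ∏ r ∈ Finset.range m, v (itinerary f ξ q (f^[j + r * q] y)) with hu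
    have hu0 : ∀ y, 0 < u y := fun y => Finset.prod_pos fun _ _ => hv _
    have hN : j + (m * q + (N - j) % q) = N := by
      rw [hm, Nat.div_add_mod']
      omega
    have h1 := sum_negMulLog_le_sum_mul_neg_log_add_log (fun y _ => (hp0 y).le) hp1
      (fun y (_ : y ∈ E) => hu0 y)
    have h2 := sum_prod_blocks_offset_le (fun b => (hv b).le) hv1.le j m ((N - j) % q) E
      (by rwa [hN])
    -- The incomplete pieces at the two ends have fewer than `q` symbols each, whence `2 * q`.
    have h3 : Real.log (∑ y ∈ E, u y) ≤ 2 * q * Real.log (Fintype.card A) := by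
      refine (Real.log_le_log (Finset.sum_pos (fun y _ => hu0 y) hE) h2).trans ?_
      rw [Real.log_pow]
      refine mul_le_mul_of_nonneg_right ?_ (Real.log_nonneg hcard)
      have := Nat.mod_lt (N - j) (by omega : 0 < q)
      exact_mod_cast (by omega : j + (N - j) % q ≤ 2 * q)
    rw [hneg] at h1
    refine h1.trans (add_le_add (Eq.le (Finset.sum_congr rfl fun y _ => ?_)) h3)
    rw [hu]
    dsimp only
    rw [Real.log_prod fun r _ => (hv _).ne', hw, ← Finset.sum_neg_distrib]
  -- Summing over the `q` offsets, each time is the start of at most one block.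
  have hsum := Finset.sum_le_sum key
  rw [Finset.sum_const, Finset.card_range, nsmul_eq_mul, Finset.sum_add_distrib, Finset.sum_const,
    Finset.card_range, nsmul_eq_mul, Finset.sum_comm] at hsum
  refine hsum.trans (add_le_add_left (Finset.sum_le_sum fun y _ => ?_) _)
  rw [← Finset.mul_sum]
  exact mul_le_mul_of_nonneg_left
    (sum_blocks_le_sum_range (w := fun i => w (f^[i] y)) (fun i => hw0 _) N) (hp0 y).le

end Counting

/-! ### Upper bound in the variational principle -/

section UpperBound

theorem measurable_itinerary {X A : Type*} [MeasurableSpace X] [MeasurableSpace A] {f : X → X}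
    (hf : Measurable f) {ξ : X → A} (hξ : Measurable ξ) (n : ℕ) : Measurable (itinerary f ξ n) :=
  measurable_pi_iff.2 fun i => hξ.comp (hf.iterate i)

theorem integral_comp_finite {X A : Type*} [MeasurableSpace X] [Fintype A] [MeasurableSpace A]
    [MeasurableSingletonClass A] (μ : Measure X) [IsFiniteMeasure μ] {η : X → A}
    (hη : Measurable η) (F : A → ℝ) :
    ∫ x, F (η x) ∂μ = ∑ a, μ.real (η ⁻¹' {a}) * F a := by
  have hF : Measurable F := measurable_of_finite F
  rw [← integral_map hη.aemeasurable hF.aestronglyMeasurable, integral_fintype .of_finite]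
  refine Finset.sum_congr rfl fun a _ => ?_
  rw [map_measureReal_apply hη (measurableSet_singleton a), smul_eq_mul]

theorem integrable_comp_finite {X A : Type*} [MeasurableSpace X] [Finite A] [MeasurableSpace A]
    [MeasurableSingletonClass A] (μ : Measure X) [IsFiniteMeasure μ] {η : X → A}
    (hη : Measurable η) (F : A → ℝ) : Integrable (fun x => F (η x)) μ :=
  (Integrable.of_finite (f := F) (μ := μ.map η)).comp_measurable hη

theorem sum_measureReal_preimage_eq_one {X A : Type*} [MeasurableSpace X] [Fintype A]
    [MeasurableSpace A] [MeasurableSingletonClass A] (μ : Measure X) [IsProbabilityMeasure μ]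
    {η : X → A} (hη : Measurable η) : ∑ a, μ.real (η ⁻¹' {a}) = 1 := by
  have h := integral_comp_finite μ hη fun _ => (1 : ℝ)
  simpa using h.symm

theorem integral_birkhoffSum {X : Type*} [MeasurableSpace X] {μ : Measure X} {f : X → X}
    (hf : MeasurePreserving f μ μ) {g : X → ℝ} (hg : Integrable g μ) (n : ℕ) :
    ∫ x, birkhoffSum f g n x ∂μ = n * ∫ x, g x ∂μ := by
  simp only [birkhoffSum]
  rw [integral_finsetSum _ fun i _ =>
    show Integrable (fun x => g (f^[i] x)) μ from (hf.iterate i).integrable_comp_of_integrable hg]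
  have : ∀ i ∈ Finset.range n, ∫ x, g (f^[i] x) ∂μ = ∫ x, g x ∂μ := by
    intro i _
    have h := integral_map (hf.iterate i).measurable.aemeasurable (f := g)
      (by rw [(hf.iterate i).map_eq]; exact hg.aestronglyMeasurable)
    rw [(hf.iterate i).map_eq] at h
    exact h.symm
  rw [Finset.sum_congr rfl this]
  simp

/-- The finite-time upper bound in the variational principle. `E` shadows every orbit up to an error
`ω` for `φ`, and `g` guesses the partition element of a point outside `B` from a nearby point. -/
theorem partitionEntropy_itinerary_le {X : Type*} [MeasurableSpace X] {μ : Measure X}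
    [IsProbabilityMeasure μ] {f : X → X} (hf : MeasurePreserving f μ μ) {k : ℕ} {ξ : X → Fin k}
    (hξ : Measurable ξ) {φ : X → ℝ} (hφ : Integrable φ μ) {n : ℕ} {E : Finset X} {θ ω : ℝ}
    (hθ0 : 0 < θ) (hθ1 : θ ≤ 1) {B : Set X} (hB : MeasurableSet B) {g : X → Fin k}
    (hE : ∀ x, ∃ y ∈ E, birkhoffSum f φ (n + 1) x - (n + 1) * ω ≤ birkhoffSum f φ (n + 1) y ∧
      ∀ i < n, f^[i] x ∉ B → ξ (f^[i] x) = g (f^[i] y)) :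
    partitionEntropy μ (itinerary f ξ n) ≤
      Real.log (∑ y ∈ E, Real.exp (birkhoffSum f φ (n + 1) y)) + n * Real.log (1 + k * θ) +
        n * (-Real.log θ * μ.real B) + (n + 1) * ω - (n + 1) * ∫ x, φ x ∂μ := by
  classical
  obtain ⟨x₀⟩ : Nonempty X := nonempty_of_isProbabilityMeasure μ
  have hEne : E.Nonempty := let ⟨y, hy, _⟩ := hE x₀; ⟨y, hy⟩
  set S := birkhoffSum f φ (n + 1) with hS
  -- Weight of the symbol `a` when `b` is guessed: one if the guess is right, `θ` otherwise. The
  -- total over `a` is at most `1 + k * θ`.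
  set Q : Fin k → Fin k → ℝ := fun a b => if a = b then 1 else θ with hQ
  have hQ0 : ∀ a b, 0 < Q a b := fun a b => by
    simp only [hQ]; split_ifs <;> [exact one_pos; exact hθ0]
  have hQθ : ∀ a b, θ ≤ Q a b := fun a b => by
    simp only [hQ]; split_ifs <;> [exact hθ1; exact le_rfl]
  have hQsum : ∀ b, ∑ a, Q a b ≤ 1 + k * θ := by
    intro b
    have : ∀ a ∈ Finset.univ, Q a b ≤ (if a = b then 1 else 0) + θ := fun a _ => by
      simp only [hQ]; split_ifs <;> linarith
    refine (Finset.sum_le_sum this).trans (Eq.le ?_)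
    simp [Finset.sum_add_distrib]
  -- The comparison weight of an itinerary mixes the guesses made from all points of `E`, each with
  -- factor `exp (S y)`.
  set q : (Fin n → Fin k) → ℝ :=
    fun a => ∑ y ∈ E, Real.exp (S y) * ∏ i : Fin n, Q (a i) (g (f^[i] y)) with hq
  have hterm : ∀ (a : Fin n → Fin k) (y : X), 0 < Real.exp (S y) * ∏ i : Fin n, Q (a i) (g (f^[i] y)) := fun a y =>
    mul_pos (Real.exp_pos _) (Finset.prod_pos fun _ _ => hQ0 _ _)
  have hq0 : ∀ a, 0 < q a := fun a => Finset.sum_pos (fun y _ => hterm a y) hEne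
  have hZ0 : 0 < ∑ y ∈ E, Real.exp (S y) := Finset.sum_pos (fun y _ => Real.exp_pos _) hEne
  have hkθ : 0 < 1 + k * θ := by positivity
  have hqsum : ∑ a, q a ≤ (∑ y ∈ E, Real.exp (S y)) * (1 + k * θ) ^ n := by
    simp only [hq]
    rw [Finset.sum_comm, Finset.sum_mul]
    refine Finset.sum_le_sum fun y _ => ?_
    rw [← Finset.mul_sum]
    refine mul_le_mul_of_nonneg_left ?_ (Real.exp_pos _).le
    rw [← Fintype.prod_sum fun (i : Fin n) a => Q a (g (f^[i] y))]
    have hprod : ∏ i : Fin n, ∑ a, Q a (g (f^[i] y)) ≤ ∏ _i : Fin n, (1 + k * θ) :=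
      Finset.prod_le_prod (fun i _ => Finset.sum_nonneg fun a _ => (hQ0 _ _).le) fun i _ => hQsum _
    simpa using hprod
  have hgibbs := sum_negMulLog_le_sum_mul_neg_log_add_log (s := Finset.univ)
    (p := fun a => μ.real (itinerary f ξ n ⁻¹' {a})) (q := q) (fun _ _ => measureReal_nonneg)
    (sum_measureReal_preimage_eq_one μ (measurable_itinerary hf.measurable hξ n)) fun a _ => hq0 a
  rw [← integral_comp_finite μ (measurable_itinerary hf.measurable hξ n)
    fun a => -Real.log (q a)] at hgibbs
  have hlog : Real.log (∑ a, q a) ≤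
      Real.log (∑ y ∈ E, Real.exp (S y)) + n * Real.log (1 + k * θ) := by
    have hpos : 0 < ∑ a, q a :=
      Finset.sum_pos (fun a _ => hq0 a) ⟨itinerary f ξ n x₀, Finset.mem_univ _⟩
    refine (Real.log_le_log hpos hqsum).trans (Eq.le ?_)
    rw [Real.log_mul hZ0.ne' (pow_pos hkθ n).ne', Real.log_pow]
  set bB : X → ℝ := B.indicator 1 with hbB
  have hbint : Integrable bB μ := (integrable_const (1 : ℝ)).indicator hB
  -- Only the term of the point shadowing `x` is kept; a factor `θ` can occur only at visits to `B`.
  have hpt : ∀ x, -Real.log (q (itinerary f ξ n x)) ≤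
      -S x + (n + 1) * ω + -Real.log θ * birkhoffSum f bB n x := by
    intro x
    obtain ⟨y, hyE, hyS, hyg⟩ := hE x
    have h1 : Real.exp (S y) * ∏ i : Fin n, Q (itinerary f ξ n x i) (g (f^[i] y)) ≤
        q (itinerary f ξ n x) :=
      Finset.single_le_sum (f := fun y => Real.exp (S y) *
        ∏ i : Fin n, Q (itinerary f ξ n x i) (g (f^[i] y))) (fun y _ => (hterm _ y).le) hyE
    have h2 := Real.log_le_log (hterm _ y) h1
    rw [Real.log_mul (Real.exp_pos _).ne' (Finset.prod_pos fun _ _ => hQ0 _ _).ne', Real.log_exp,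
      Real.log_prod fun _ _ => (hQ0 _ _).ne'] at h2
    have h3 : ∀ i ∈ (Finset.univ : Finset (Fin n)), Real.log θ * bB (f^[i] x) ≤
        Real.log (Q (itinerary f ξ n x i) (g (f^[i] y))) := by
      intro i _
      by_cases hi : f^[i] x ∈ B
      · simp only [hbB, indicator_of_mem hi, Pi.one_apply, mul_one]
        exact Real.log_le_log hθ0 (hQθ _ _)
      · have := hyg i i.2 hi
        simp [hbB, indicator_of_notMem hi, hQ, itinerary, this]
    have h4 := Finset.sum_le_sum h3
    rw [← Finset.mul_sum] at h4
    rw [Finset.sum_fin_eq_sum_range (fun i : Fin n => bB (f^[i] x))] at h4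
    have h5 : ∑ i ∈ Finset.range n, (if h : i < n then bB (f^[((⟨i, h⟩ : Fin n) : ℕ)] x) else 0) =
        birkhoffSum f bB n x := by
      rw [birkhoffSum]
      refine Finset.sum_congr rfl fun i hi => ?_
      rw [dif_pos (Finset.mem_range.1 hi)]
    rw [h5] at h4
    linarith
  have hSint : Integrable S μ :=
    integrable_finsetSum _ fun i _ => (hf.iterate i).integrable_comp_of_integrable hφ
  have hbSint : Integrable (birkhoffSum f bB n) μ :=
    integrable_finsetSum _ fun i _ => (hf.iterate i).integrable_comp_of_integrable hbint
  have hint := integral_mono (integrable_comp_finite μ (measurable_itinerary hf.measurable hξ n)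
    fun a => -Real.log (q a)) ((hSint.neg.add (integrable_const ((n + 1) * ω))).add
      (hbSint.const_mul (-Real.log θ))) hpt
  have hcalc : ∫ x, ((-S + fun _ => (n + 1) * ω : X → ℝ) +
      fun x => -Real.log θ * birkhoffSum f bB n x : X → ℝ) x ∂μ
      = -((n + 1) * ∫ x, φ x ∂μ) + (n + 1) * ω + n * (-Real.log θ * μ.real B) := by
    rw [integral_add' (hSint.neg.add (integrable_const _)) (hbSint.const_mul _),
      integral_add' hSint.neg (integrable_const _), integral_neg', integral_const_mul (-Real.log θ),
      integral_birkhoffSum hf hbint, hS, integral_birkhoffSum hf hφ]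
    simp only [integral_const, probReal_univ, one_smul, hbB, integral_indicator_one hB]
    push_cast
    ring
  have hint' := hint.trans hcalc.le
  rw [partitionEntropy]
  linarith

theorem dynDist_lt_iff {X : Type*} [MetricSpace X] {f : X → X} {n : ℕ} {x z : X} {δ : ℝ} :
    dynDist f n x z < δ ↔ ∀ i < n + 1, dist (f^[i] x) (f^[i] z) < δ := by
  simp [dynDist, Finset.sup'_lt_iff]

/-- Dynamical balls of radius `ε / 2` about `ε`-separated points are disjoint. This bounds the
cardinality of separated sets and, later, the pressure of zero by the topological entropy. -/
theorem IsSeparatedSet.card_le_coverMincard {X : Type*} [MetricSpace X] {f : X → X} {n : ℕ} {ε : ℝ}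
    {E : Finset X} (hE : IsSeparatedSet f n ε (E : Set X)) :
    (E.card : ℕ∞) ≤ Dynamics.coverMincard f univ {p : X × X | dist p.1 p.2 < ε / 2} (n + 1) := by
  refine le_trans (Dynamics.IsDynNetIn.card_le_netMaxcard ⟨subset_univ _, ?_⟩)
    (Dynamics.netMaxcard_le_coverMincard _ _ _)
  intro x hx z hz hxz
  refine Set.disjoint_left.2 fun y hxy hzy => (hE hx hz hxz).not_gt (dynDist_lt_iff.2 fun i hi => ?_)
  have h1 : dist (f^[i] x) (f^[i] y) < ε / 2 := Dynamics.mem_ball_dynEntourage.1 hxy i hi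
  have h2 : dist (f^[i] z) (f^[i] y) < ε / 2 := Dynamics.mem_ball_dynEntourage.1 hzy i hi
  linarith [dist_triangle_right (f^[i] x) (f^[i] z) (f^[i] y)]

theorem dynDist_comm {X : Type*} [MetricSpace X] (f : X → X) (n : ℕ) (x z : X) :
    dynDist f n x z = dynDist f n z x := by
  simp only [dynDist, dist_comm]

/-- A separated set of largest cardinality spans, since a point far from all of it could be added.
Compactness bounds the cardinalities. -/
theorem exists_isSeparatedSet_forall_exists_dynDist_lt {X : Type*} [MetricSpace X] [CompactSpace X]
    {f : X → X} (hf : Continuous f) (n : ℕ) {δ : ℝ} (hδ : 0 < δ) :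
    ∃ E : Finset X, IsSeparatedSet f n δ (E : Set X) ∧ ∀ x, ∃ y ∈ E, dynDist f n x y < δ := by
  classical
  have hfin := Dynamics.coverMincard_finite_of_isCompact_uniformContinuous (F := univ)
    isCompact_univ (CompactSpace.uniformContinuous_of_continuous hf)
    (Metric.dist_mem_uniformity (half_pos hδ)) (n + 1)
  obtain ⟨N, hN⟩ := ENat.ne_top_iff_exists.1 hfin.ne
  have hbd : ∀ E : Finset X, IsSeparatedSet f n δ (E : Set X) → E.card ≤ N := fun E hE => by
    have := hE.card_le_coverMincard
    rw [← hN] at this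
    exact_mod_cast this
  obtain ⟨E, hE, hmax⟩ : ∃ E : Finset X, IsSeparatedSet f n δ (E : Set X) ∧
      ∀ F : Finset X, IsSeparatedSet f n δ (F : Set X) → F.card ≤ E.card := by
    let P : ℕ → Prop := fun m => ∃ E : Finset X, IsSeparatedSet f n δ (E : Set X) ∧ E.card = m
    have h0 : P 0 := ⟨∅, by simp [IsSeparatedSet], rfl⟩
    obtain ⟨E, hE, hc⟩ : P (Nat.findGreatest P N) := Nat.findGreatest_spec (Nat.zero_le N) h0
    exact ⟨E, hE, fun F hF => hc ▸ Nat.le_findGreatest (hbd F hF) ⟨F, hF, rfl⟩⟩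
  refine ⟨E, hE, fun x => ?_⟩
  by_contra! h
  have hx : x ∉ E := fun hx => (h x hx).not_gt (dynDist_lt_iff.2 fun i _ => by simpa using hδ)
  have hins : IsSeparatedSet f n δ ((insert x E : Finset X) : Set X) := by
    rw [Finset.coe_insert]
    exact hE.insert fun y hy _ => ⟨h y hy, dynDist_comm f n y x ▸ h y hy⟩
  have := hmax _ hins
  rw [Finset.card_insert_of_notMem hx] at this
  omega

theorem ofReal_sum_exp_le_partitionSum {X : Type*} [MetricSpace X] {f : X → X} {φ : X → ℝ} {n : ℕ}
    {ε : ℝ} {E : Finset X} (hE : IsSeparatedSet f n ε (E : Set X)) :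
    ENNReal.ofReal (∑ x ∈ E, Real.exp (birkhoffSum f φ (n + 1) x)) ≤ partitionSum f φ n ε := by
  rw [ENNReal.ofReal_sum_of_nonneg fun _ _ => (Real.exp_pos _).le]
  exact le_iSup₂ (f := fun (E : Finset X) (_ : IsSeparatedSet f n ε (E : Set X)) =>
    ∑ x ∈ E, ENNReal.ofReal (Real.exp (birkhoffSum f φ (n + 1) x))) E hE

theorem pressureAtScale_eq_expGrowthSup {X : Type*} [MetricSpace X] (f : X → X) (φ : X → ℝ) (ε : ℝ) :
    pressureAtScale f φ ε = ExpGrowth.expGrowthSup fun n => partitionSum f φ n ε := rfl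

theorem EReal_exp_coe_mul_natCast (b : ℝ) (n : ℕ) :
    EReal.exp ((b : EReal) * n) = ENNReal.ofReal (Real.exp (b * n)) := by
  rw [← EReal.exp_coe]
  push_cast
  rfl

/-- The points of a finite measurable partition can be recognised from nearby points, outside a set
of small measure. -/
theorem exists_guess {X : Type*} [MetricSpace X] [CompactSpace X] [MeasurableSpace X] [BorelSpace X]
    (μ : Measure X) [IsProbabilityMeasure μ] {k : ℕ} {ξ : X → Fin k} (hξ : Measurable ξ) {η : ℝ}
    (hη : 0 < η) :
    ∃ B : Set X, MeasurableSet B ∧ μ.real B ≤ η ∧ ∃ δ₀ > 0, ∀ δ ≤ δ₀, ∃ g : X → Fin k,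
      ∀ x y, x ∉ B → dist x y < δ → ξ x = g y := by
  obtain ⟨x₀⟩ : Nonempty X := nonempty_of_isProbabilityMeasure μ
  have hk : 0 < (k : ℝ) := by exact_mod_cast (Fin.pos (ξ x₀))
  have hη' : ENNReal.ofReal (η / k) ≠ 0 := (ENNReal.ofReal_pos.2 (div_pos hη hk)).ne'
  have hm : ∀ j, MeasurableSet (ξ ⁻¹' {j}) := fun j => hξ (measurableSet_singleton j)
  -- Inner regularity: compact cores of the `k` cells, each losing at most `η / k`; the lost part is
  -- `B`.
  choose K hKsub hKc hKlt using fun j => (hm j).exists_isCompact_sdiff_lt (measure_ne_top μ _) hη'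
  have hdisj : ∀ i j, i ≠ j → Disjoint (K i) (K j) := fun i j hij =>
    Disjoint.mono (hKsub i) (hKsub j) (Disjoint.preimage ξ (disjoint_singleton.2 hij))
  refine ⟨⋃ j, (ξ ⁻¹' {j} \ K j), .iUnion fun j => (hm j).diff (hKc j).measurableSet, ?_, ?_⟩
  · refine (measureReal_iUnion_fintype_le _).trans ?_
    have : ∀ j ∈ Finset.univ, μ.real (ξ ⁻¹' {j} \ K j) ≤ η / k := fun j _ =>
      ENNReal.toReal_le_of_le_ofReal (div_pos hη hk).le (hKlt j).le
    refine (Finset.sum_le_sum this).trans (Eq.le ?_)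
    simp
    field_simp
  · have hev : ∀ᶠ δ in 𝓝[>] (0 : ℝ), ∀ i j, i ≠ j →
        Disjoint (Metric.thickening δ (K i)) (Metric.thickening δ (K j)) := by
      simp only [eventually_all]
      intro i j hij
      obtain ⟨δ, hδ, h⟩ := (hdisj i j hij).exists_thickenings (hKc i) (hKc j).isClosed
      filter_upwards [Ioo_mem_nhdsGT hδ] with r hr
      exact h.mono (Metric.thickening_mono hr.2.le _) (Metric.thickening_mono hr.2.le _)
    obtain ⟨δ₀, hδ₀, hδpos⟩ := (hev.and self_mem_nhdsWithin).exists
    refine ⟨δ₀, hδpos, fun δ hδ => ?_⟩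
    classical
    -- The guess is the cell whose core has `y` in its `δ₀`-thickening. These thickenings are
    -- disjoint, so the guess is unambiguous; the default `ξ x₀` is never used near a core.
    refine ⟨fun y => if h : ∃ j, y ∈ Metric.thickening δ₀ (K j) then h.choose else ξ x₀,
      fun x y hx hxy => ?_⟩
    have hxK : x ∈ K (ξ x) := by
      by_contra hn
      exact hx (mem_iUnion.2 ⟨ξ x, rfl, hn⟩)
    have hy : y ∈ Metric.thickening δ₀ (K (ξ x)) :=
      Metric.mem_thickening_iff.2 ⟨x, hxK, by rw [dist_comm]; linarith⟩
    have hex : ∃ j, y ∈ Metric.thickening δ₀ (K j) := ⟨_, hy⟩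
    dsimp only
    rw [dif_pos hex]
    by_contra hne
    exact Set.disjoint_left.1 (hδ₀ _ _ hne) hy hex.choose_spec

theorem birkhoffSum_sub_le {X : Type*} {f : X → X} {φ : X → ℝ} {n : ℕ} {ω : ℝ} {x y : X}
    (h : ∀ i < n, φ (f^[i] x) - ω ≤ φ (f^[i] y)) :
    birkhoffSum f φ n x - n * ω ≤ birkhoffSum f φ n y := by
  have := Finset.sum_le_sum fun i (hi : i ∈ Finset.range n) => h i (Finset.mem_range.1 hi)
  rw [Finset.sum_sub_distrib] at this
  simpa [birkhoffSum] using this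

/-- The pressure bounds the free energy of every invariant measure from above. -/
theorem entropyOfPartition_le_of_topPressure_lt {X : Type*} [MetricSpace X] [CompactSpace X]
    [MeasurableSpace X] [BorelSpace X] {f : X → X} (hf : Continuous f) {μ : Measure X}
    [IsProbabilityMeasure μ] (hμ : MeasurePreserving f μ μ) (φ : C(X, ℝ)) {k : ℕ} {ξ : X → Fin k}
    (hξ : Measurable ξ) {b : ℝ} (hb : topPressure f φ < b) :
    entropyOfPartition f μ ξ ≤ ((b - ∫ x, φ x ∂μ : ℝ) : EReal) := by
  refine EReal.le_of_forall_lt_iff_le.1 fun c hc => ?_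
  rw [EReal.coe_lt_coe_iff] at hc
  set I := ∫ x, φ x ∂μ with hI
  obtain ⟨x₀⟩ : Nonempty X := nonempty_of_isProbabilityMeasure μ
  -- Four errors of size `η` per unit time: wrong guesses, visits to `B`, the modulus of continuity
  -- of `φ`, and the extra term in a sum over `n + 1` times.
  set η := (c - (b - I)) / 4 with hη
  have hη0 : 0 < η := by rw [hη]; linarith
  -- the weight of a wrong guess
  obtain ⟨θ, ⟨hθ0, hθ1⟩, hθk⟩ : ∃ θ ∈ Ioc (0 : ℝ) 1, Real.log (1 + k * θ) ≤ η := by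
    have hcont : ContinuousAt (fun θ : ℝ => Real.log (1 + k * θ)) 0 :=
      ContinuousAt.log (by fun_prop) (by simp)
    have h1 : ∀ᶠ θ in 𝓝 (0 : ℝ), Real.log (1 + k * θ) < η :=
      hcont.eventually_lt_const (by simpa using hη0)
    obtain ⟨θ, h, h'⟩ := ((h1.filter_mono nhdsWithin_le_nhds).and
      (Ioc_mem_nhdsGT (zero_lt_one' ℝ))).exists
    exact ⟨θ, h', h.le⟩
  have hlogθ : 0 ≤ -Real.log θ := neg_nonneg.2 (Real.log_nonpos hθ0.le hθ1)
  -- `B` is chosen after `θ`, because its measure has to beat `-log θ`; the `+ 1` keeps the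
  -- denominator positive when `θ = 1`.
  obtain ⟨B, hB, hBη, δ₀, hδ₀, hguess⟩ := exists_guess μ hξ
    (show 0 < η / (-Real.log θ + 1) by positivity)
  obtain ⟨δ₁, hδ₁, hmod⟩ := Metric.uniformContinuous_iff.1
    (CompactSpace.uniformContinuous_of_continuous φ.continuous) η hη0
  have hδ : 0 < min δ₀ δ₁ := lt_min hδ₀ hδ₁
  set δ := min δ₀ δ₁
  obtain ⟨g, hg⟩ := hguess δ (min_le_left _ _)
  have hBη' : -Real.log θ * μ.real B ≤ η := by
    have := mul_le_mul_of_nonneg_left hBη hlogθ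
    refine this.trans ?_
    rw [mul_div_assoc', div_le_iff₀ (by linarith)]
    nlinarith
  have hpress : pressureAtScale f φ δ < b :=
    (le_iSup₂ (f := fun ε (_ : 0 < ε) => pressureAtScale f φ ε) δ hδ).trans_lt hb
  rw [pressureAtScale_eq_expGrowthSup] at hpress
  have hev := ExpGrowth.eventually_le_exp hpress
  have hlim : ∀ᶠ n : ℕ in atTop, (η - I) / n ≤ η := by
    have := tendsto_const_div_atTop_nhds_zero_nat (η - I)
    exact (this.eventually_lt_const hη0).mono fun _ h => h.le
  refine limsup_le_of_le (by isBoundedDefault) ?_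
  filter_upwards [hev, hlim, eventually_gt_atTop 0] with n hn hn' hn0
  rw [EReal.coe_le_coe_iff]
  obtain ⟨E, hE, hspan⟩ := exists_isSeparatedSet_forall_exists_dynDist_lt hf n hδ
  have hZ := (ofReal_sum_exp_le_partitionSum (φ := φ) hE).trans hn
  rw [EReal_exp_coe_mul_natCast, ENNReal.ofReal_le_ofReal_iff (Real.exp_pos _).le] at hZ
  have hEne : E.Nonempty := let ⟨y, hy, _⟩ := hspan x₀; ⟨y, hy⟩
  have hlogZ := Real.log_le_log (Finset.sum_pos (fun y _ => Real.exp_pos _) hEne) hZ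
  rw [Real.log_exp] at hlogZ
  have hmain := partitionEntropy_itinerary_le (E := E) (ω := η) (n := n) (g := g) (φ := φ) hμ hξ
    (φ.continuous.integrable_of_hasCompactSupport (HasCompactSupport.of_compactSpace _))
    hθ0 hθ1 hB fun x => by
      obtain ⟨y, hy, hxy⟩ := hspan x
      rw [dynDist_lt_iff] at hxy
      refine ⟨y, hy, ?_, fun i hi hiB => hg _ _ hiB (hxy i (by omega))⟩
      have := birkhoffSum_sub_le (f := f) (φ := φ) (n := n + 1) (ω := η) (x := x) (y := y)
        fun i hi => by
          have := hmod ((hxy i hi).trans_le (min_le_right _ _))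
          rw [Real.dist_eq] at this
          linarith [(abs_lt.1 this).2]
      simpa using this
  rw [← hI] at hmain
  have hn0' : (0 : ℝ) < n := by exact_mod_cast hn0
  rw [div_le_iff₀ hn0'] at hn' ⊢
  have h1 := mul_le_mul_of_nonneg_left hθk hn0'.le
  have h2 := mul_le_mul_of_nonneg_left hBη' hn0'.le
  have h3 : c = b - I + 4 * η := by rw [hη]; ring
  rw [h3]
  linarith

theorem metricEntropy_add_integral_le_topPressure {X : Type*} [MetricSpace X] [CompactSpace X]
    [MeasurableSpace X] [BorelSpace X] {f : X → X} (hf : Continuous f) {μ : Measure X}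
    [IsProbabilityMeasure μ] (hμ : MeasurePreserving f μ μ) (φ : C(X, ℝ)) :
    metricEntropy f μ + ((∫ x, φ x ∂μ : ℝ) : EReal) ≤ topPressure f φ := by
  refine EReal.le_of_forall_lt_iff_le.1 fun b hb => ?_
  have h : metricEntropy f μ ≤ ((b - ∫ x, φ x ∂μ : ℝ) : EReal) :=
    iSup_le fun k => iSup₂_le fun ξ hξ => entropyOfPartition_le_of_topPressure_lt hf hμ φ hξ hb
  refine (add_le_add_left h _).trans (Eq.le ?_)
  rw [← EReal.coe_add, sub_add_cancel]

end UpperBound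

/-! ### Partitions with null boundary and weak* limits -/

section NullBoundary

/-- A map into a discrete space is discontinuous at every frontier point of its fibres. -/
theorem measure_frontier_preimage_singleton {X A : Type*} [TopologicalSpace X] [MeasurableSpace X]
    [TopologicalSpace A] [DiscreteTopology A] {μ : Measure X} {η : X → A}
    (hη : ∀ᵐ x ∂μ, ContinuousAt η x) (a : A) : μ (frontier (η ⁻¹' {a})) = 0 := by
  rw [measure_eq_zero_iff_ae_notMem]
  filter_upwards [hη] with x hcont hx
  by_cases h : η x = a
  · exact hx.2 (mem_interior_iff_mem_nhds.2 (hcont.preimage_mem_nhds (by simp [h])))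
  · have h1 : η ⁻¹' {a}ᶜ ∈ 𝓝 x := hcont.preimage_mem_nhds (by simp [h])
    obtain ⟨y, hy, hy'⟩ := mem_closure_iff_nhds.1 hx.1 _ h1
    exact hy hy'

theorem ae_continuousAt_itinerary {X A : Type*} [TopologicalSpace X] [MeasurableSpace X]
    [TopologicalSpace A] {μ : Measure X} {f : X → X} (hf : Continuous f)
    (hμ : MeasurePreserving f μ μ) {ξ : X → A} (hξ : ∀ᵐ x ∂μ, ContinuousAt ξ x) (n : ℕ) :
    ∀ᵐ x ∂μ, ContinuousAt (itinerary f ξ n) x := by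
  have h : ∀ i : Fin n, ∀ᵐ x ∂μ, ContinuousAt ξ (f^[i] x) := fun i =>
    (hμ.iterate i).quasiMeasurePreserving.ae hξ
  filter_upwards [ae_all_iff.2 h] with x hx
  exact continuousAt_pi.2 fun i => (hx i).comp (hf.iterate i).continuousAt

/-- Cover by finitely many balls of radius below `ε / 2` with null frontier and record which balls
contain `x`. Points with the same record share a ball, and the record can only jump on the
frontiers. -/
theorem exists_partition_dist_lt_ae_continuousAt {X : Type*} [MetricSpace X] [CompactSpace X]
    [MeasurableSpace X] [BorelSpace X] (μ : Measure X) [IsProbabilityMeasure μ] {ε : ℝ}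
    (hε : 0 < ε) :
    ∃ (k : ℕ) (ξ : X → Fin k), Measurable ξ ∧ (∀ x y, ξ x = ξ y → dist x y < ε) ∧
      ∀ᵐ x ∂μ, ContinuousAt ξ x := by
  classical
  have h : ∀ x : X, ∃ r ∈ Ioo 0 (ε / 2), μ (frontier (Metric.ball x r)) = 0 := fun x => by
    simpa only [Metric.thickening_singleton] using
      exists_null_frontier_thickening μ {x} (half_pos hε)
  choose r hr hr0 using h
  obtain ⟨t, ht⟩ := isCompact_univ.elim_finite_subcover (fun x => Metric.ball x (r x))
    (fun _ => Metric.isOpen_ball) fun x _ => mem_iUnion.2 ⟨x, Metric.mem_ball_self (hr x).1⟩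
  let e := Fintype.equivFin (t → Bool)
  let ζ : X → t → Bool := fun x c => decide (x ∈ Metric.ball (c : X) (r c))
  have hζ : Measurable ζ := measurable_pi_iff.2 fun c =>
    measurable_to_bool (by
      convert (Metric.isOpen_ball (x := (c : X)) (ε := r c)).measurableSet using 1
      ext x
      simp [ζ])
  refine ⟨_, fun x => e (ζ x), (measurable_of_finite e).comp hζ, fun x y hxy => ?_, ?_⟩
  · have hxy : ζ x = ζ y := e.injective hxy
    obtain ⟨c, hc, hxc⟩ := mem_iUnion₂.1 (ht (mem_univ x))
    have hyc : y ∈ Metric.ball c (r c) := by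
      have := congrFun hxy ⟨c, hc⟩
      simpa [ζ, Metric.mem_ball.1 hxc] using this
    have h1 := Metric.mem_ball.1 hxc
    have h2 := Metric.mem_ball.1 hyc
    have h3 := (hr c).2
    linarith [dist_triangle_right x y c]
  · have hae : ∀ᵐ x ∂μ, ∀ c : t, x ∉ frontier (Metric.ball (c : X) (r c)) :=
      ae_all_iff.2 fun c => measure_eq_zero_iff_ae_notMem.1 (hr0 c)
    filter_upwards [hae] with x hx
    refine (continuous_of_discreteTopology (f := e)).continuousAt.comp (continuousAt_pi.2 fun c => ?_)
    by_cases hxc : x ∈ Metric.ball (c : X) (r c)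
    · refine (continuousAt_const (y := true)).congr ?_
      filter_upwards [Metric.isOpen_ball.mem_nhds hxc] with y hy
      exact (decide_eq_true hy).symm
    · have hxc' : x ∉ closure (Metric.ball (c : X) (r c)) := fun hcl =>
        hx c ⟨hcl, by rwa [Metric.isOpen_ball.interior_eq]⟩
      refine (continuousAt_const (y := false)).congr ?_
      filter_upwards [isClosed_closure.isOpen_compl.mem_nhds hxc'] with y hy
      exact (decide_eq_false fun h => hy (subset_closure h)).symm

/-- Portmanteau theorem: the measure of a set with null frontier passes to the weak* limit. -/
theorem tendsto_integral_comp_finite {X A ι : Type*} [MetricSpace X] [MeasurableSpace X]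
    [BorelSpace X] [Fintype A] [MeasurableSpace A] [MeasurableSingletonClass A]
    [TopologicalSpace A] [DiscreteTopology A] {L : Filter ι} {μs : ι → ProbabilityMeasure X}
    {μ : ProbabilityMeasure X} (hlim : Tendsto μs L (𝓝 μ)) {η : X → A} (hη : Measurable η)
    (hc : ∀ᵐ x ∂(μ : Measure X), ContinuousAt η x) (F : A → ℝ) :
    Tendsto (fun i => ∫ x, F (η x) ∂(μs i : Measure X)) L (𝓝 (∫ x, F (η x) ∂(μ : Measure X))) := by
  simp only [integral_comp_finite _ hη]
  refine tendsto_finsetSum _ fun a _ => Tendsto.mul_const _ ?_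
  exact (ENNReal.tendsto_toReal (measure_ne_top _ _)).comp
    (ProbabilityMeasure.tendsto_measure_of_null_frontier_of_tendsto' hlim
      (measure_frontier_preimage_singleton hc a))

end NullBoundary

/-! ### Weighted orbit averages -/

section Empirical

/-- The average of the orbit segments of length `N` of the points of `E`, with weights `p`. -/
noncomputable def empiricalMeasure {X : Type*} [MeasurableSpace X] (f : X → X) (E : Finset X) (p : X → ℝ)
    (N : ℕ) : Measure X :=
  ∑ y ∈ E, ∑ i ∈ Finset.range N, ENNReal.ofReal (p y / N) • Measure.dirac (f^[i] y)

theorem isProbabilityMeasure_empiricalMeasure {X : Type*} [MeasurableSpace X] (f : X → X)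
    {E : Finset X} {p : X → ℝ} (hp : ∀ y, 0 ≤ p y) (hp1 : ∑ y ∈ E, p y = 1) {N : ℕ} (hN : N ≠ 0) :
    IsProbabilityMeasure (empiricalMeasure f E p N) := by
  constructor
  simp only [empiricalMeasure, Measure.coe_finsetSum, Finset.sum_apply, Measure.smul_apply,
    measure_univ, smul_eq_mul, mul_one, Finset.sum_const, Finset.card_range]
  rw [← Finset.smul_sum, ← ENNReal.ofReal_sum_of_nonneg fun y _ => div_nonneg (hp y) N.cast_nonneg,
    ← Finset.sum_div, hp1, ← ENNReal.ofReal_nsmul]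
  simp [hN]

theorem integral_empiricalMeasure {X : Type*} [MeasurableSpace X] [MeasurableSingletonClass X]
    (f : X → X) {E : Finset X} {p : X → ℝ} (hp : ∀ y, 0 ≤ p y) (N : ℕ) (g : X → ℝ) :
    ∫ x, g x ∂(empiricalMeasure f E p N) = (∑ y ∈ E, p y * birkhoffSum f g N y) / N := by
  have hint : ∀ y i, Integrable g (ENNReal.ofReal (p y / N) • Measure.dirac (f^[i] y)) :=
    fun y i => (integrable_dirac enorm_lt_top).smul_measure ENNReal.ofReal_ne_top
  rw [empiricalMeasure, integral_finsetSum_measure fun y _ =>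
    integrable_finsetSum_measure.2 fun i _ => hint y i, Finset.sum_div]
  refine Finset.sum_congr rfl fun y _ => ?_
  rw [integral_finsetSum_measure fun i _ => hint y i, birkhoffSum, Finset.mul_sum, Finset.sum_div]
  refine Finset.sum_congr rfl fun i _ => ?_
  rw [integral_smul_measure, integral_dirac,
    ENNReal.toReal_ofReal (div_nonneg (hp y) N.cast_nonneg), smul_eq_mul]
  ring

end Empirical

/-! ### Invariance tested on continuous functions -/

section Invariant

/-- Finite Borel measures are determined by the integrals of continuous functions, so invariance
becomes a family of weak*-continuous equations. -/
theorem mem_invariantMeasures_iff {X : Type*} [MetricSpace X] [CompactSpace X] [MeasurableSpace X]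
    [BorelSpace X] {f : X → X} (hf : Continuous f) {μ : ProbabilityMeasure X} :
    μ ∈ invariantMeasures f ↔
      ∀ g : C(X, ℝ), ∫ x, g (f x) ∂(μ : Measure X) = ∫ x, g x ∂(μ : Measure X) := by
  constructor
  · intro h g
    have h1 := integral_map (μ := (μ : Measure X)) hf.measurable.aemeasurable
      g.continuous.aestronglyMeasurable
    rw [MeasurePreserving.map_eq h] at h1
    exact h1.symm
  · intro h
    refine ⟨hf.measurable, ?_⟩
    have : IsFiniteMeasure (Measure.map f (μ : Measure X)) := inferInstance
    refine ext_of_forall_integral_eq_of_IsFiniteMeasure fun g => ?_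
    rw [integral_map hf.measurable.aemeasurable g.continuous.aestronglyMeasurable]
    exact h g.toContinuousMap

theorem isClosed_invariantMeasures {X : Type*} [MetricSpace X] [CompactSpace X] [MeasurableSpace X]
    [BorelSpace X] {f : X → X} (hf : Continuous f) : IsClosed (invariantMeasures f) := by
  have : invariantMeasures f = ⋂ g : C(X, ℝ), {μ : ProbabilityMeasure X |
      ∫ x, g (f x) ∂(μ : Measure X) = ∫ x, g x ∂(μ : Measure X)} := by
    ext μ
    simp [mem_invariantMeasures_iff hf]
  rw [this]
  refine isClosed_iInter fun g => isClosed_eq ?_ (ProbabilityMeasure.continuous_integral_continuousMap g)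
  exact ProbabilityMeasure.continuous_integral_continuousMap (g.comp ⟨f, hf⟩)

/-- The Birkhoff sums of `g ∘ f` and `g` telescope to `g (f^[N] y) - g y`, so orbit averages are
almost invariant for large `N`. -/
theorem abs_integral_comp_sub_integral_empiricalMeasure_le {X : Type*} [MetricSpace X]
    [CompactSpace X] [MeasurableSpace X] [BorelSpace X] (f : X → X) {E : Finset X} {p : X → ℝ}
    (hp : ∀ y, 0 ≤ p y) (hp1 : ∑ y ∈ E, p y = 1) (N : ℕ) (g : C(X, ℝ)) :
    |∫ x, g (f x) ∂(empiricalMeasure f E p N) - ∫ x, g x ∂(empiricalMeasure f E p N)| ≤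
      2 * ‖g‖ / N := by
  rw [integral_empiricalMeasure f hp N g, integral_empiricalMeasure f hp N fun x => g (f x),
    ← sub_div, abs_div, Nat.abs_cast, ← Finset.sum_sub_distrib]
  refine div_le_div_of_nonneg_right ?_ N.cast_nonneg
  have h : ∀ y ∈ E, |p y * birkhoffSum f (fun x => g (f x)) N y - p y * birkhoffSum f g N y| ≤
      p y * (2 * ‖g‖) := by
    intro y _
    rw [← mul_sub, abs_mul, abs_of_nonneg (hp y)]
    refine mul_le_mul_of_nonneg_left ?_ (hp y)
    have h1 : birkhoffSum f (fun x => g (f x)) N y - birkhoffSum f g N y = g (f^[N] y) - g y := by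
      rw [← birkhoffSum_apply_sub_birkhoffSum]
      congr 1
      simp only [birkhoffSum, ← Function.iterate_succ_apply, ← Function.iterate_succ_apply']
    rw [h1]
    have h2 := g.norm_coe_le_norm (f^[N] y)
    have h3 := g.norm_coe_le_norm y
    rw [Real.norm_eq_abs] at h2 h3
    linarith [abs_sub (g (f^[N] y)) (g y)]
  refine (Finset.abs_sum_le_sum_abs _ _).trans ((Finset.sum_le_sum h).trans (Eq.le ?_))
  rw [← Finset.sum_mul, hp1, one_mul]

end Invariant

/-! ### Lower bound in the variational principle -/

section LowerBound

/-- Average `p` with the uniform distribution. The weight becomes positive everywhere, so its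
logarithm is finite, and it is at least `p / 2`, so the cost is at most `log 2`, which vanishes per
unit time as the block length grows. -/
theorem exists_blockWeight {A : Type*} [Fintype A] [Nonempty A] {p : A → ℝ} (hp : ∀ a, 0 ≤ p a)
    (hp1 : ∑ a, p a = 1) :
    ∃ v : A → ℝ, (∀ a, 0 < v a) ∧ ∑ a, v a = 1 ∧
      ∑ a, p a * -Real.log (v a) ≤ ∑ a, Real.negMulLog (p a) + Real.log 2 := by
  have hK : (0 : ℝ) < Fintype.card A := by exact_mod_cast Fintype.card_pos
  have hv : ∀ a, 0 < (p a + 1 / Fintype.card A) / 2 := fun a => by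
    have := hp a
    positivity
  refine ⟨fun a => (p a + 1 / Fintype.card A) / 2, hv, ?_, ?_⟩
  · rw [← Finset.sum_div, Finset.sum_add_distrib, hp1]
    simp
  · have h : ∀ a ∈ Finset.univ, p a * -Real.log ((p a + 1 / Fintype.card A) / 2) ≤
        Real.negMulLog (p a) + p a * Real.log 2 := by
      intro a _
      rcases (hp a).eq_or_lt with h0 | h0
      · simp [← h0]
      · have h1 : p a / 2 ≤ (p a + 1 / Fintype.card A) / 2 := by
          have : 0 < 1 / (Fintype.card A : ℝ) := by positivity
          linarith
        have h2 := Real.log_le_log (half_pos h0) h1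
        rw [Real.log_div h0.ne' two_ne_zero] at h2
        rw [Real.negMulLog]
        nlinarith
    refine (Finset.sum_le_sum h).trans (Eq.le ?_)
    rw [Finset.sum_add_distrib, ← Finset.sum_mul, hp1, one_mul]

theorem injOn_itinerary_of_isSeparatedSet {X A : Type*} [MetricSpace X] {f : X → X} {ξ : X → A}
    {ε : ℝ} (hξ : ∀ x y, ξ x = ξ y → dist x y < ε) {n : ℕ} {E : Set X}
    (hE : IsSeparatedSet f n ε E) : InjOn (itinerary f ξ (n + 1)) E := by
  intro x hx y hy hxy
  by_contra hne
  exact (hE hx hy hne).not_gt (dynDist_lt_iff.2 fun i hi => hξ _ _ (itinerary_eq_iff.1 hxy i hi))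

/-- The weights `exp (S_N φ)`, normalised over `E`. -/
noncomputable def gibbsWeight {X : Type*} (f : X → X) (φ : X → ℝ) (E : Finset X) (N : ℕ) (y : X) : ℝ :=
  Real.exp (birkhoffSum f φ N y) / ∑ z ∈ E, Real.exp (birkhoffSum f φ N z)

theorem gibbsWeight_nonneg {X : Type*} (f : X → X) (φ : X → ℝ) (E : Finset X) (N : ℕ) (y : X) :
    0 ≤ gibbsWeight f φ E N y :=
  div_nonneg (Real.exp_pos _).le (Finset.sum_nonneg fun _ _ => (Real.exp_pos _).le)

theorem sum_gibbsWeight {X : Type*} (f : X → X) (φ : X → ℝ) {E : Finset X} (hE : E.Nonempty)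
    (N : ℕ) : ∑ y ∈ E, gibbsWeight f φ E N y = 1 := by
  simp only [gibbsWeight]
  rw [← Finset.sum_div, div_self (Finset.sum_pos (fun _ _ => Real.exp_pos _) hE).ne']

theorem mul_log_sum_exp_le_integral {X A : Type*} [MeasurableSpace X] [MeasurableSingletonClass X]
    [Fintype A] [Nonempty A] {f : X → X} {ξ : X → A} {q : ℕ} {v : (Fin q → A) → ℝ}
    (hv : ∀ b, 0 < v b) (hv1 : ∑ b, v b = 1) {N : ℕ} (hN : N ≠ 0) (hqN : q ≤ N) {E : Finset X}
    (hE : E.Nonempty) (hEinj : InjOn (itinerary f ξ N) E) (φ : X → ℝ) :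
    q * Real.log (∑ y ∈ E, Real.exp (birkhoffSum f φ N y)) ≤
      N * (q * ∫ x, φ x ∂(empiricalMeasure f E (gibbsWeight f φ E N) N) +
        ∫ x, -Real.log (v (itinerary f ξ q x)) ∂(empiricalMeasure f E (gibbsWeight f φ E N) N)) +
      q * (2 * q * Real.log (Fintype.card A)) := by
  have hN' : (N : ℝ) ≠ 0 := by exact_mod_cast hN
  have h := mul_log_sum_exp_le hv hv1 hqN hE hEinj (birkhoffSum f φ N)
  rw [integral_empiricalMeasure f (gibbsWeight_nonneg f φ E N) N φ,
    integral_empiricalMeasure f (gibbsWeight_nonneg f φ E N) N, mul_add, mul_div_cancel₀ _ hN',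
    mul_left_comm, mul_div_cancel₀ _ hN']
  simp only [gibbsWeight, birkhoffSum] at h ⊢
  linarith

/-- The approximate lower bound in the variational principle, at block length `q`. -/
theorem mul_le_partitionEntropy_of_tendsto {X : Type*} [MetricSpace X] [CompactSpace X]
    [MeasurableSpace X] [BorelSpace X] {f : X → X} (hf : Continuous f) {φ : C(X, ℝ)} {ε c : ℝ}
    {L : Filter ℕ} [L.NeBot] (hL : L ≤ atTop) {E : ℕ → Finset X} (hEne : ∀ n, (E n).Nonempty)
    (hE : ∀ᶠ n in L, IsSeparatedSet f n ε (E n : Set X) ∧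
      c * n ≤ Real.log (∑ y ∈ E n, Real.exp (birkhoffSum f φ (n + 1) y)))
    {μs : ℕ → ProbabilityMeasure X} (hμs : ∀ n, (μs n : Measure X) =
      empiricalMeasure f (E n) (gibbsWeight f φ (E n) (n + 1)) (n + 1))
    {μ : ProbabilityMeasure X} (hlim : Tendsto μs L (𝓝 μ)) (hinv : μ ∈ invariantMeasures f)
    {k : ℕ} {ξ : X → Fin k} (hξm : Measurable ξ) (hξd : ∀ x y, ξ x = ξ y → dist x y < ε)
    (hξc : ∀ᵐ x ∂(μ : Measure X), ContinuousAt ξ x) (q : ℕ) :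
    q * c ≤ partitionEntropy (μ : Measure X) (itinerary f ξ q) + Real.log 2 +
      q * ∫ x, φ x ∂(μ : Measure X) := by
  obtain ⟨x₀⟩ : Nonempty X := nonempty_of_isProbabilityMeasure (μ : Measure X)
  have : Nonempty (Fin k) := ⟨ξ x₀⟩
  have hm := measurable_itinerary hf.measurable hξm q
  -- The block weight comes from the limit measure and does not depend on `n`, so its logarithm can
  -- be integrated along the convergence.
  obtain ⟨v, hv, hv1, hvH⟩ := exists_blockWeight (fun a => measureReal_nonneg)
    (sum_measureReal_preimage_eq_one (μ : Measure X) hm)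
  have hlimv := tendsto_integral_comp_finite hlim hm (ae_continuousAt_itinerary hf hinv hξc q)
    fun a => -Real.log (v a)
  have hlimφ : Tendsto (fun n => ∫ x, φ x ∂(μs n : Measure X)) L (𝓝 (∫ x, φ x ∂(μ : Measure X))) :=
    ((ProbabilityMeasure.continuous_integral_continuousMap φ).tendsto μ).comp hlim
  -- The end pieces of the block decomposition, plus `q * c` because the growth hypothesis has `c *
  -- n` while orbits have length `n + 1`.
  set D : ℝ := q * (2 * q * Real.log (Fintype.card (Fin k))) + q * c with hD
  have hlow : Tendsto (fun n : ℕ => q * c - D / ((n : ℝ) + 1)) L (𝓝 (q * c - 0)) := by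
    refine Tendsto.sub tendsto_const_nhds (Tendsto.mono_left ?_ hL)
    have h := (tendsto_const_div_atTop_nhds_zero_nat D).comp (tendsto_add_atTop_nat 1)
    refine h.congr fun n => ?_
    simp
  have hev : ∀ᶠ n : ℕ in L, q * c - D / ((n : ℝ) + 1) ≤ q * ∫ x, φ x ∂(μs n : Measure X) +
      ∫ x, -Real.log (v (itinerary f ξ q x)) ∂(μs n : Measure X) := by
    filter_upwards [hE, hL (eventually_ge_atTop q)] with n hn hqn
    have h1 := mul_log_sum_exp_le_integral hv hv1 n.succ_ne_zero (Nat.le_succ_of_le hqn) (hEne n)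
      (injOn_itinerary_of_isSeparatedSet hξd hn.1) φ
    rw [Nat.succ_eq_add_one, ← hμs] at h1
    have h2 := mul_le_mul_of_nonneg_left hn.2 (Nat.cast_nonneg (α := ℝ) q)
    push_cast at h1
    have hn1 : (0 : ℝ) < (n : ℝ) + 1 := by positivity
    rw [sub_le_iff_le_add, ← sub_le_iff_le_add', le_div_iff₀ hn1]
    rw [hD]
    linarith
  have h := le_of_tendsto_of_tendsto hlow ((hlimφ.const_mul _).add hlimv) hev
  rw [integral_comp_finite _ hm fun a => -Real.log (v a)] at h
  rw [partitionEntropy]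
  linarith

theorem le_entropyOfPartition_add {X : Type*} [MeasurableSpace X] {f : X → X} {μ : Measure X}
    {k : ℕ} {ξ : X → Fin k} {c I d : ℝ}
    (h : ∀ q : ℕ, q * c ≤ partitionEntropy μ (itinerary f ξ q) + d + q * I) :
    (c : EReal) ≤ entropyOfPartition f μ ξ + (I : EReal) := by
  have hlim : Tendsto (fun q : ℕ => ((c - I - d / q : ℝ) : EReal)) atTop (𝓝 ((c - I : ℝ) : EReal)) := by
    refine (continuous_coe_real_ereal.tendsto _).comp ?_
    simpa using tendsto_const_nhds.sub (tendsto_const_div_atTop_nhds_zero_nat d)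
  have hle : ((c - I : ℝ) : EReal) ≤ entropyOfPartition f μ ξ := by
    rw [← hlim.limsup_eq]
    refine limsup_le_limsup ?_
    filter_upwards [eventually_gt_atTop 0] with q hq
    have hq' : (0 : ℝ) < q := by exact_mod_cast hq
    rw [EReal.coe_le_coe_iff, le_div_iff₀ hq', sub_mul, div_mul_cancel₀ _ hq'.ne']
    linarith [h q]
  refine le_trans (Eq.le ?_) (add_le_add_left hle _)
  rw [← EReal.coe_add, sub_add_cancel]

theorem exists_finset_of_lt_partitionSum {X : Type*} [MetricSpace X] {f : X → X} {φ : X → ℝ} {n : ℕ}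
    {ε b : ℝ} (h : ENNReal.ofReal (Real.exp b) < partitionSum f φ n ε) :
    ∃ E : Finset X, E.Nonempty ∧ IsSeparatedSet f n ε (E : Set X) ∧
      b ≤ Real.log (∑ y ∈ E, Real.exp (birkhoffSum f φ (n + 1) y)) := by
  simp only [partitionSum, lt_iSup_iff] at h
  obtain ⟨E, hE, hlt⟩ := h
  rw [← ENNReal.ofReal_sum_of_nonneg fun _ _ => (Real.exp_pos _).le,
    ENNReal.ofReal_lt_ofReal_iff_of_nonneg (Real.exp_pos _).le] at hlt
  refine ⟨E, Finset.nonempty_of_ne_empty ?_, hE, ?_⟩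
  · rintro rfl
    exact (Real.exp_pos b).not_gt (by simpa using hlt)
  · rw [← Real.log_exp b]
    exact Real.log_le_log (Real.exp_pos _) hlt.le

/-- Every number below the pressure is exceeded by the free energy of some invariant measure. -/
theorem exists_le_metricEntropy_add_integral {X : Type*} [MetricSpace X] [CompactSpace X]
    [Nonempty X] [MeasurableSpace X] [BorelSpace X] {f : X → X} (hf : Continuous f) (φ : C(X, ℝ))
    {c : ℝ} (hc : (c : EReal) < topPressure f φ) :
    ∃ μ ∈ invariantMeasures f, (c : EReal) ≤
      metricEntropy f (μ : Measure X) + ((∫ x, φ x ∂(μ : Measure X) : ℝ) : EReal) := by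
  obtain ⟨ε, hε, hcε⟩ : ∃ ε > 0, (c : EReal) < pressureAtScale f φ ε := by
    simpa only [topPressure, lt_iSup_iff, exists_prop] using hc
  -- The room between `c` and `c'` gives the strict inequality needed to extract a set from the
  -- supremum.
  obtain ⟨c', hcc', hc'⟩ := EReal.lt_iff_exists_real_btwn.1 hcε
  rw [EReal.coe_lt_coe_iff] at hcc'
  rw [pressureAtScale_eq_expGrowthSup] at hc'
  have hfreq : ∃ᶠ n in atTop, ∃ E : Finset X, E.Nonempty ∧ IsSeparatedSet f n ε (E : Set X) ∧
      c * n ≤ Real.log (∑ y ∈ E, Real.exp (birkhoffSum f φ (n + 1) y)) := by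
    refine ((ExpGrowth.frequently_exp_le hc').and_eventually (eventually_gt_atTop 0)).mono ?_
    rintro n ⟨hn, hn0⟩
    refine exists_finset_of_lt_partitionSum (lt_of_lt_of_le ?_ hn)
    rw [EReal_exp_coe_mul_natCast, ENNReal.ofReal_lt_ofReal_iff_of_nonneg (Real.exp_pos _).le,
      Real.exp_lt_exp]
    exact mul_lt_mul_of_pos_right hcc' (by exact_mod_cast hn0)
  set s := {n : ℕ | ∃ E : Finset X, E.Nonempty ∧ IsSeparatedSet f n ε (E : Set X) ∧
    c * n ≤ Real.log (∑ y ∈ E, Real.exp (birkhoffSum f φ (n + 1) y))} with hs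
  have hchoice : ∀ n : ℕ, ∃ E : Finset X, E.Nonempty ∧ (n ∈ s → IsSeparatedSet f n ε (E : Set X) ∧
      c * n ≤ Real.log (∑ y ∈ E, Real.exp (birkhoffSum f φ (n + 1) y))) := by
    intro n
    by_cases hn : n ∈ s
    · obtain ⟨E, h1, h2⟩ := hn
      exact ⟨E, h1, fun _ => h2⟩
    -- A filler at the other times: it only keeps the set nonempty, so that the averages are
    -- probability measures.
    · exact ⟨{Classical.arbitrary X}, Finset.singleton_nonempty _, fun h => absurd h hn⟩
  choose E hEne hE using hchoice
  have hneBot : (atTop ⊓ 𝓟 s).NeBot := frequently_mem_iff_neBot.1 hfreq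
  -- Along an ultrafilter concentrated on the good times, compactness gives a limit without
  -- extracting subsequences.
  let U : Ultrafilter ℕ := Ultrafilter.of (atTop ⊓ 𝓟 s)
  have hU : (U : Filter ℕ) ≤ atTop ⊓ 𝓟 s := Ultrafilter.of_le _
  have hUtop : (U : Filter ℕ) ≤ atTop := hU.trans inf_le_left
  have hUs : ∀ᶠ n in (U : Filter ℕ), n ∈ s := hU.trans inf_le_right (mem_principal_self s)
  let μs : ℕ → ProbabilityMeasure X := fun n =>
    ⟨empiricalMeasure f (E n) (gibbsWeight f φ (E n) (n + 1)) (n + 1),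
      isProbabilityMeasure_empiricalMeasure f (gibbsWeight_nonneg f φ _ _)
        (sum_gibbsWeight f φ (hEne n) _) n.succ_ne_zero⟩
  obtain ⟨μ, -, hlim⟩ : ∃ μ ∈ (univ : Set (ProbabilityMeasure X)), Tendsto μs U (𝓝 μ) :=
    isCompact_univ.ultrafilter_le_nhds (U.map μs) (by simp)
  have hinv : μ ∈ invariantMeasures f := by
    rw [mem_invariantMeasures_iff hf]
    intro g
    have h1 : Tendsto (fun n => ∫ x, g (f x) ∂(μs n : Measure X) - ∫ x, g x ∂(μs n : Measure X)) U
        (𝓝 (∫ x, g (f x) ∂(μ : Measure X) - ∫ x, g x ∂(μ : Measure X))) :=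
      (((ProbabilityMeasure.continuous_integral_continuousMap (g.comp ⟨f, hf⟩)).tendsto μ).comp
        hlim).sub (((ProbabilityMeasure.continuous_integral_continuousMap g).tendsto μ).comp hlim)
    have h2 : Tendsto (fun n => ∫ x, g (f x) ∂(μs n : Measure X) - ∫ x, g x ∂(μs n : Measure X)) U
        (𝓝 0) := by
      refine squeeze_zero_norm (fun n => abs_integral_comp_sub_integral_empiricalMeasure_le f
        (gibbsWeight_nonneg f φ _ _) (sum_gibbsWeight f φ (hEne n) _) (n + 1) g) ?_
      exact ((tendsto_const_div_atTop_nhds_zero_nat (2 * ‖g‖)).comp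
        (tendsto_add_atTop_nat 1)).mono_left hUtop
    exact sub_eq_zero.1 (tendsto_nhds_unique h1 h2)
  -- The partition is chosen after the limit `μ`, whose null sets decide which boundaries are
  -- negligible.
  obtain ⟨k, ξ, hξm, hξd, hξc⟩ := exists_partition_dist_lt_ae_continuousAt (μ : Measure X) hε
  refine ⟨μ, hinv, (le_entropyOfPartition_add fun q => mul_le_partitionEntropy_of_tendsto hf hUtop
    hEne (hUs.mono fun n hn => hE n hn) (fun _ => rfl) hlim hinv hξm hξd hξc q).trans ?_⟩
  refine add_le_add_left ?_ _
  exact le_iSup_of_le k (le_iSup₂ (f := fun (ξ : X → Fin k) (_ : Measurable ξ) =>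
    entropyOfPartition f (μ : Measure X) ξ) ξ hξm)

end LowerBound

/-! ### Finiteness of the pressure -/

section Finiteness

theorem integrable_continuousMap {X : Type*} [MetricSpace X] [CompactSpace X] [MeasurableSpace X]
    [BorelSpace X] (μ : ProbabilityMeasure X) (φ : C(X, ℝ)) : Integrable φ (μ : Measure X) :=
  φ.continuous.integrable_of_hasCompactSupport (HasCompactSupport.of_compactSpace _)

theorem partitionSum_zero_le_coverMincard {X : Type*} [MetricSpace X] (f : X → X) (n : ℕ) (ε : ℝ) :
    partitionSum f 0 n ε ≤
      (Dynamics.coverMincard f univ {p : X × X | dist p.1 p.2 < ε / 2} (n + 1) : ℝ≥0∞) := by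
  refine iSup₂_le fun E hE => ?_
  have h := ENat.toENNReal_mono hE.card_le_coverMincard
  simpa [birkhoffSum] using h

theorem topPressure_zero_le_coverEntropy {X : Type*} [MetricSpace X] (f : X → X) :
    topPressure f 0 ≤ Dynamics.coverEntropy f univ := by
  refine iSup₂_le fun ε hε => EReal.le_of_forall_lt_iff_le.1 fun b hb => ?_
  have h1 := (Dynamics.coverEntropyEntourage_le_coverEntropy f univ
    (Metric.dist_mem_uniformity (half_pos hε))).trans_lt hb
  have h2 := (tendsto_add_atTop_nat 1).eventually (ExpGrowth.eventually_le_exp h1)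
  rw [pressureAtScale_eq_expGrowthSup, ← ExpGrowth.expGrowthSup_exp (a := (b : EReal))]
  refine ExpGrowth.expGrowthSup_le_of_eventually_le (b := ENNReal.ofReal (Real.exp b))
    ENNReal.ofReal_ne_top ?_
  filter_upwards [h2] with n hn
  -- The shift from `n` to `n + 1` costs the constant factor `exp b`, invisible to the growth rate.
  refine (partitionSum_zero_le_coverMincard f n ε).trans (hn.trans (Eq.le ?_))
  rw [EReal_exp_coe_mul_natCast, EReal_exp_coe_mul_natCast, ← ENNReal.ofReal_mul (Real.exp_pos _).le,
    ← Real.exp_add]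
  congr 2
  push_cast
  ring

theorem topPressure_zero_nonneg {X : Type*} [MetricSpace X] [Nonempty X] (f : X → X) :
    0 ≤ topPressure f 0 := by
  refine le_trans ?_ (le_iSup₂ (f := fun ε (_ : 0 < ε) => pressureAtScale f 0 ε) 1 one_pos)
  rw [pressureAtScale_eq_expGrowthSup,
    ← ExpGrowth.expGrowthSup_const one_ne_zero ENNReal.one_ne_top]
  refine ExpGrowth.expGrowthSup_monotone fun n => ?_
  have h := ofReal_sum_exp_le_partitionSum (f := f) (φ := 0) (n := n) (ε := 1)
    (E := {Classical.arbitrary X}) (by simp [IsSeparatedSet])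
  simpa [birkhoffSum] using h

theorem metricEntropy_nonneg {X : Type*} [MeasurableSpace X] (f : X → X) (μ : Measure X)
    [IsProbabilityMeasure μ] : 0 ≤ metricEntropy f μ := by
  have h : 0 ≤ entropyOfPartition f μ (fun _ : X => (0 : Fin 1)) := by
    rw [entropyOfPartition, ← limsup_const (f := (atTop : Filter ℕ)) (0 : EReal)]
    refine limsup_le_limsup (Eventually.of_forall fun n => ?_)
    refine EReal.coe_nonneg.2 (div_nonneg (Finset.sum_nonneg fun a _ => ?_) n.cast_nonneg)
    exact Real.negMulLog_nonneg measureReal_nonneg measureReal_le_one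
  exact h.trans (le_iSup_of_le 1 (le_iSup₂ (f := fun (ξ : X → Fin 1) (_ : Measurable ξ) =>
    entropyOfPartition f μ ξ) _ measurable_const))

/-- The lower half of the variational principle as a test: an upper bound for the pressure need only
be checked on invariant measures. -/
theorem topPressure_le_of_forall {X : Type*} [MetricSpace X] [CompactSpace X] [Nonempty X]
    [MeasurableSpace X] [BorelSpace X] {f : X → X} (hf : Continuous f) (φ : C(X, ℝ)) {c : EReal}
    (h : ∀ μ ∈ invariantMeasures f,
      metricEntropy f (μ : Measure X) + ((∫ x, φ x ∂(μ : Measure X) : ℝ) : EReal) ≤ c) :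
    topPressure f φ ≤ c := by
  refine EReal.ge_of_forall_gt_iff_ge.1 fun b hb => ?_
  obtain ⟨μ, hμ, hb'⟩ := exists_le_metricEntropy_add_integral hf φ hb
  exact hb'.trans (h μ hμ)

/-- A by-product of the lower bound, as the pressure of zero exceeds `-1`. -/
theorem invariantMeasures_nonempty {X : Type*} [MetricSpace X] [CompactSpace X] [Nonempty X]
    [MeasurableSpace X] [BorelSpace X] {f : X → X} (hf : Continuous f) :
    (invariantMeasures f).Nonempty := by
  have h : ((-1 : ℝ) : EReal) < topPressure f (0 : C(X, ℝ)) :=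
    lt_of_lt_of_le (by exact_mod_cast neg_one_lt_zero) (topPressure_zero_nonneg f)
  obtain ⟨μ, hμ, -⟩ := exists_le_metricEntropy_add_integral hf 0 h
  exact ⟨μ, hμ⟩

/-- Above, `P(φ) ≤ P(0) + ‖φ‖` and `P(0)` is at most the topological entropy; below, `P(φ) ≥ ∫ φ dμ`
for any invariant `μ`. -/
theorem exists_topPressure_eq_coe {X : Type*} [MetricSpace X] [CompactSpace X] [Nonempty X]
    [MeasurableSpace X] [BorelSpace X] {f : X → X} (hf : Continuous f)
    (htop : Dynamics.coverEntropy f univ < ⊤) :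
    ∃ P : C(X, ℝ) → ℝ, ∀ φ : C(X, ℝ), topPressure f φ = P φ := by
  refine ⟨fun φ => (topPressure f φ).toReal, fun φ => (EReal.coe_toReal ?_ ?_).symm⟩
  · have h0 : topPressure f (0 : C(X, ℝ)) < ⊤ := (topPressure_zero_le_coverEntropy f).trans_lt htop
    have h : topPressure f φ ≤ topPressure f (0 : C(X, ℝ)) + (‖φ‖ : EReal) := by
      refine topPressure_le_of_forall hf φ fun μ hμ => ?_
      have h1 := metricEntropy_add_integral_le_topPressure hf hμ (0 : C(X, ℝ))
      simp only [ContinuousMap.zero_apply, integral_zero, EReal.coe_zero, add_zero] at h1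
      refine add_le_add h1 (EReal.coe_le_coe_iff.2 ?_)
      refine (integral_mono (integrable_continuousMap μ φ) (integrable_const ‖φ‖) fun x =>
        (le_abs_self _).trans (φ.norm_coe_le_norm x)).trans (Eq.le ?_)
      simp
    exact (h.trans_lt (EReal.add_lt_top h0.ne (EReal.coe_ne_top _))).ne
  · obtain ⟨μ, hμ⟩ := invariantMeasures_nonempty hf
    have h := metricEntropy_add_integral_le_topPressure hf hμ φ
    have h1 := (add_le_add_left (metricEntropy_nonneg f (μ : Measure X))
      ((∫ x, φ x ∂(μ : Measure X) : ℝ) : EReal)).trans h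
    rw [zero_add] at h1
    exact ((EReal.bot_lt_coe _).trans_le h1).ne'

end Finiteness

/-! ### Semi-continuity, maximising measures and their invariance -/

section EntropyMap

theorem hEntropy_le {X : Type*} [MetricSpace X] [MeasurableSpace X] {f : X → X}
    (μ : ProbabilityMeasure X) (φ : C(X, ℝ)) :
    hEntropy f μ ≤ topPressure f φ - ((∫ x, φ x ∂(μ : Measure X) : ℝ) : EReal) :=
  iInf_le _ φ

theorem hEntropy_add_integral_le {X : Type*} [MetricSpace X] [MeasurableSpace X] {f : X → X}
    (μ : ProbabilityMeasure X) (φ : C(X, ℝ)) :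
    hEntropy f μ + ((∫ x, φ x ∂(μ : Measure X) : ℝ) : EReal) ≤ topPressure f φ :=
  EReal.add_le_of_le_sub (hEntropy_le μ φ)

variable {X : Type*} [MetricSpace X] [CompactSpace X] [MeasurableSpace X] [BorelSpace X] {f : X → X}

theorem metricEntropy_le_hEntropy (hf : Continuous f) {μ : ProbabilityMeasure X}
    (hμ : μ ∈ invariantMeasures f) : metricEntropy f (μ : Measure X) ≤ hEntropy f μ :=
  le_iInf fun φ => (EReal.le_sub_iff_add_le (Or.inl (EReal.coe_ne_bot _))
    (Or.inl (EReal.coe_ne_top _))).2 (metricEntropy_add_integral_le_topPressure hf hμ φ)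

variable {P : C(X, ℝ) → ℝ}

/-- With real pressures, `𝔥` is an infimum of continuous functions. -/
theorem upperSemicontinuous_hEntropy (hP : ∀ φ : C(X, ℝ), topPressure f φ = P φ) :
    UpperSemicontinuous (hEntropy f : ProbabilityMeasure X → EReal) := by
  have h : (hEntropy f : ProbabilityMeasure X → EReal) = fun μ : ProbabilityMeasure X =>
      ⨅ φ : C(X, ℝ), ((P φ - ∫ x, φ x ∂(μ : Measure X) : ℝ) : EReal) := by
    funext μ
    simp only [hEntropy, hP, EReal.coe_sub]
  rw [h]
  exact upperSemicontinuous_iInf fun φ => (continuous_coe_real_ereal.comp (continuous_const.sub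
    (ProbabilityMeasure.continuous_integral_continuousMap φ))).upperSemicontinuous

/-- An upper semi-continuous function attains its maximum on the compact set of invariant measures.
There it dominates every `h_ν(f) + ∫ φ dν`, hence their supremum, the pressure. -/
theorem exists_invariant_hEntropy_add_integral_eq [Nonempty X] (hf : Continuous f)
    (hP : ∀ φ : C(X, ℝ), topPressure f φ = P φ) (φ : C(X, ℝ)) :
    ∃ μ ∈ invariantMeasures f,
      hEntropy f μ + ((∫ x, φ x ∂(μ : Measure X) : ℝ) : EReal) = topPressure f φ := by
  have husc : UpperSemicontinuous fun μ : ProbabilityMeasure X =>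
      hEntropy f μ + ((∫ x, φ x ∂(μ : Measure X) : ℝ) : EReal) :=
    (upperSemicontinuous_hEntropy hP).add' (continuous_coe_real_ereal.comp
      (ProbabilityMeasure.continuous_integral_continuousMap φ)).upperSemicontinuous
      fun μ => EReal.continuousAt_add (Or.inr (EReal.coe_ne_bot _)) (Or.inr (EReal.coe_ne_top _))
  obtain ⟨μ, hμ, hmax⟩ := (husc.upperSemicontinuousOn (invariantMeasures f)).exists_isMaxOn
    (invariantMeasures_nonempty hf) (isClosed_invariantMeasures hf).isCompact
  refine ⟨μ, hμ, (hEntropy_add_integral_le μ φ).antisymm ?_⟩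
  exact topPressure_le_of_forall hf φ fun ν hν =>
    (add_le_add_left (metricEntropy_le_hEntropy hf hν) _).trans (hmax hν)

/-- Coboundaries integrate to zero against invariant measures, which determine the pressure. -/
theorem topPressure_add_comp_sub_le [Nonempty X] (hf : Continuous f) (φ g : C(X, ℝ)) :
    topPressure f (φ + (g.comp ⟨f, hf⟩ - g) : C(X, ℝ)) ≤ topPressure f φ := by
  refine topPressure_le_of_forall hf _ fun μ hμ => ?_
  have h1 := (mem_invariantMeasures_iff hf).1 hμ g
  have h2 : ∫ x, (φ + (g.comp ⟨f, hf⟩ - g) : C(X, ℝ)) x ∂(μ : Measure X) =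
      ∫ x, φ x ∂(μ : Measure X) := by
    have h3 := integral_add (integrable_continuousMap μ φ)
      ((integrable_continuousMap μ (g.comp ⟨f, hf⟩)).sub (integrable_continuousMap μ g))
    have h4 := integral_sub (integrable_continuousMap μ (g.comp ⟨f, hf⟩))
      (integrable_continuousMap μ g)
    simp only [ContinuousMap.comp_apply, ContinuousMap.coe_mk, Pi.sub_apply] at h3 h4
    simp only [ContinuousMap.add_apply, ContinuousMap.sub_apply, ContinuousMap.comp_apply,
      ContinuousMap.coe_mk]
    rw [h3, h4, h1, sub_self, add_zero]
  rw [h2]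
  exact metricEntropy_add_integral_le_topPressure hf hμ φ

/-- A maximising measure is tangent to the pressure at `φ`. As adding `g ∘ f - g` does not raise the
pressure, the integral of this coboundary is at most zero; replacing `g` by `-g` gives equality. -/
theorem mem_invariantMeasures_of_hEntropy_add_integral_eq [Nonempty X] (hf : Continuous f)
    (hP : ∀ φ : C(X, ℝ), topPressure f φ = P φ) {φ : C(X, ℝ)} {μ : ProbabilityMeasure X}
    (h : hEntropy f μ + ((∫ x, φ x ∂(μ : Measure X) : ℝ) : EReal) = topPressure f φ) :
    μ ∈ invariantMeasures f := by
  rw [mem_invariantMeasures_iff hf]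
  have key : ∀ g : C(X, ℝ), ∫ x, g (f x) ∂(μ : Measure X) ≤ ∫ x, g x ∂(μ : Measure X) := by
    intro g
    set ψ : C(X, ℝ) := φ + (g.comp ⟨f, hf⟩ - g) with hψ
    have h1 := topPressure_add_comp_sub_le hf φ g
    rw [← hψ, hP, hP, EReal.coe_le_coe_iff] at h1
    have h2 := add_le_add_left (hEntropy_le (f := f) μ ψ)
      ((∫ x, φ x ∂(μ : Measure X) : ℝ) : EReal)
    rw [h, hP, hP, ← EReal.coe_sub, ← EReal.coe_add, EReal.coe_le_coe_iff] at h2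
    have h3 := integral_add (integrable_continuousMap μ φ)
      ((integrable_continuousMap μ (g.comp ⟨f, hf⟩)).sub (integrable_continuousMap μ g))
    have h4 := integral_sub (integrable_continuousMap μ (g.comp ⟨f, hf⟩))
      (integrable_continuousMap μ g)
    simp only [ContinuousMap.comp_apply, ContinuousMap.coe_mk, Pi.sub_apply] at h3 h4
    simp only [hψ, ContinuousMap.add_apply, ContinuousMap.sub_apply, ContinuousMap.comp_apply,
      ContinuousMap.coe_mk] at h2
    linarith
  intro g
  have h1 := key g
  have h2 := key (-g)
  simp only [ContinuousMap.neg_apply, integral_neg] at h2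
  linarith

end EntropyMap

/-! ### The concave envelope -/

section Envelope

theorem exists_convexCombination_mem_invariantMeasures {X : Type*} [MeasurableSpace X] {f : X → X}
    (μ ν : invariantMeasures f) {p q : ℝ}
    (hp : 0 ≤ p) (hq : 0 ≤ q) (hpq : p + q = 1) :
    ∃ ρ : invariantMeasures f, (ρ.1 : Measure X) =
      ENNReal.ofReal p • (μ.1 : Measure X) + ENNReal.ofReal q • (ν.1 : Measure X) := by
  have hprob : IsProbabilityMeasure
      (ENNReal.ofReal p • (μ.1 : Measure X) + ENNReal.ofReal q • (ν.1 : Measure X)) := by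
    constructor
    simp only [Measure.coe_add, Measure.coe_smul, Pi.add_apply, Pi.smul_apply, measure_univ,
      smul_eq_mul, mul_one]
    rw [← ENNReal.ofReal_add hp hq, hpq, ENNReal.ofReal_one]
  refine ⟨⟨⟨_, hprob⟩, ?_, ?_⟩, rfl⟩
  · exact μ.2.measurable
  · change Measure.map f (_ + _) = _ + _
    rw [Measure.map_add _ _ μ.2.measurable, Measure.map_smul, Measure.map_smul, μ.2.map_eq,
      ν.2.map_eq]

variable {X : Type*} [MetricSpace X] [CompactSpace X] [MeasurableSpace X] [BorelSpace X] {f : X → X}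

theorem integral_convexCombination {μ ν ρ : ProbabilityMeasure X} {p q : ℝ} (hp : 0 ≤ p)
    (hq : 0 ≤ q) (h : (ρ : Measure X) =
      ENNReal.ofReal p • (μ : Measure X) + ENNReal.ofReal q • (ν : Measure X)) (φ : C(X, ℝ)) :
    ∫ x, φ x ∂(ρ : Measure X) =
      p * ∫ x, φ x ∂(μ : Measure X) + q * ∫ x, φ x ∂(ν : Measure X) := by
  rw [h, integral_add_measure ((integrable_continuousMap μ φ).smul_measure ENNReal.ofReal_ne_top)
    ((integrable_continuousMap ν φ).smul_measure ENNReal.ofReal_ne_top), integral_smul_measure,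
    integral_smul_measure, ENNReal.toReal_ofReal hp, ENNReal.toReal_ofReal hq]
  rfl

/-- Linear functionals on `C(X, ℝ)` with the topology of pointwise convergence. -/
abbrev WeakFunctional (X : Type*) [TopologicalSpace X] : Type _ :=
  WeakBilin (LinearMap.id : (C(X, ℝ) →ₗ[ℝ] ℝ) →ₗ[ℝ] (C(X, ℝ) →ₗ[ℝ] ℝ))

/-- Integration against a probability measure, as a linear functional. -/
noncomputable def integralFunctional (μ : ProbabilityMeasure X) : C(X, ℝ) →ₗ[ℝ] ℝ where
  toFun φ := ∫ x, φ x ∂(μ : Measure X)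
  map_add' φ ψ := integral_add (integrable_continuousMap μ φ) (integrable_continuousMap μ ψ)
  map_smul' c _ := integral_const_mul c _

/-- A continuous affine function on the invariant measures is dominated by the integral of some
continuous function, almost tightly at a given point. -/
theorem exists_continuousMap_lt_integral (hf : Continuous f) {T : invariantMeasures f → ℝ}
    (hT : Continuous T) (hTa : IsAffineOnMeasures T) (μ : invariantMeasures f) {ε : ℝ}
    (hε : 0 < ε) :
    ∃ φ : C(X, ℝ), (∀ ν : invariantMeasures f, T ν < ∫ x, φ x ∂(ν.1 : Measure X)) ∧
      ∫ x, φ x ∂(μ.1 : Measure X) < T μ + ε := by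
  have : CompactSpace (invariantMeasures f) :=
    isCompact_iff_compactSpace.1 (isClosed_invariantMeasures hf).isCompact
  have hT2 : T2Space (WeakFunctional X) :=
    T2Space.of_injective_continuous (fun _ _ h => DFunLike.coe_injective (F := C(X, ℝ) →ₗ[ℝ] ℝ) h)
      (WeakBilin.coeFn_continuous (LinearMap.id : (C(X, ℝ) →ₗ[ℝ] ℝ) →ₗ[ℝ] (C(X, ℝ) →ₗ[ℝ] ℝ)))
  let J : invariantMeasures f → WeakFunctional X := fun ν => integralFunctional ν.1
  have hJ : Continuous J := WeakBilin.continuous_of_continuous_eval _ fun φ =>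
    (ProbabilityMeasure.continuous_integral_continuousMap φ).comp continuous_subtype_val
  -- The graph of `T` is compact by continuity and convex by affinity; it misses the point at height
  -- `ε` above `μ`, which can therefore be strictly separated from it.
  let s : Set (WeakFunctional X × ℝ) := range fun ν => (J ν, T ν)
  have hs : IsClosed s := (isCompact_range (hJ.prodMk hT)).isClosed
  have hsc : Convex ℝ s := by
    rintro _ ⟨ν₁, rfl⟩ _ ⟨ν₂, rfl⟩ a b ha hb hab
    obtain ⟨ρ, hρ⟩ := exists_convexCombination_mem_invariantMeasures ν₁ ν₂ ha hb hab
    refine ⟨ρ, Prod.ext ?_ ?_⟩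
    · exact LinearMap.ext fun φ => integral_convexCombination ha hb hρ φ
    · obtain rfl : b = 1 - a := by linarith
      exact hTa ν₁ ν₂ ρ a ha (by linarith) hρ
  have hx : (J μ, T μ + ε) ∉ s := by
    rintro ⟨ν, hν⟩
    obtain ⟨h1, h2⟩ := Prod.ext_iff.1 hν
    have hmeas : (ν.1 : Measure X) = (μ.1 : Measure X) :=
      ext_of_forall_integral_eq_of_IsFiniteMeasure fun g =>
        LinearMap.congr_fun h1 g.toContinuousMap
    have hνμ : ν = μ := Subtype.ext (Subtype.ext hmeas)
    rw [hνμ] at h2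
    dsimp only at h2
    linarith
  obtain ⟨F, u, hFs, hFx⟩ := geometric_hahn_banach_closed_point hsc hs hx
  -- Continuous functionals for the topology of pointwise convergence are evaluations at elements of
  -- `C(X, ℝ)`.
  obtain ⟨φ₀, hφ₀⟩ := LinearMap.dualEmbedding_surjective
    (LinearMap.id : (C(X, ℝ) →ₗ[ℝ] ℝ) →ₗ[ℝ] (C(X, ℝ) →ₗ[ℝ] ℝ))
    (F.comp (ContinuousLinearMap.inl ℝ (WeakFunctional X) ℝ))
  set c := F (0, 1) with hc
  have hF : ∀ (ν : invariantMeasures f) (t : ℝ),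
      F (J ν, t) = ∫ x, φ₀ x ∂(ν.1 : Measure X) + t * c := by
    intro ν t
    have h1 : F (J ν, 0) = ∫ x, φ₀ x ∂(ν.1 : Measure X) := (DFunLike.congr_fun hφ₀ (J ν)).symm
    have h2 : ((J ν, t) : WeakFunctional X × ℝ) = (J ν, 0) + t • (0, 1) := by simp
    rw [h2, map_add, map_smul, h1, smul_eq_mul]
  rw [hF] at hFx
  have hFs' : ∀ ν : invariantMeasures f, ∫ x, φ₀ x ∂(ν.1 : Measure X) + T ν * c < u := fun ν => by
    rw [← hF]
    exact hFs _ ⟨ν, rfl⟩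
  -- Comparing the separated point with the graph point directly below it shows that the hyperplane
  -- is not vertical. Solving its equation for the height gives the function `(u - φ₀) / c`.
  have hc0 : 0 < c := by
    have := (hFs' μ).trans hFx
    have h : 0 < ε * c := by linarith
    exact pos_of_mul_pos_right h hε.le
  have hφ : ∀ ν : invariantMeasures f,
      ∫ x, (c⁻¹ • (ContinuousMap.const X u - φ₀) : C(X, ℝ)) x ∂(ν.1 : Measure X) =
        (u - ∫ x, φ₀ x ∂(ν.1 : Measure X)) / c := by
    intro ν
    simp only [ContinuousMap.smul_apply, ContinuousMap.sub_apply, ContinuousMap.const_apply,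
      smul_eq_mul]
    rw [integral_const_mul, integral_sub (integrable_const u) (integrable_continuousMap ν.1 φ₀)]
    simp
    ring
  refine ⟨c⁻¹ • (ContinuousMap.const X u - φ₀), fun ν => ?_, ?_⟩
  · rw [hφ, lt_div_iff₀ hc0]
    linarith [hFs' ν]
  · rw [hφ, div_lt_iff₀ hc0]
    linarith

/-- If `∫ φ dν` exceeds `T ν ≥ h_ν(f)` for all invariant `ν`, then the pressure of `-φ` is at most
zero, so testing `𝔥` with `-φ` gives `𝔥_μ(f) ≤ ∫ φ dμ`, which is as close to `T μ` as desired. -/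
theorem hEntropy_le_entropyEnvelope [Nonempty X] (hf : Continuous f) (μ : invariantMeasures f) :
    hEntropy f μ.1 ≤ entropyEnvelope f μ := by
  refine le_iInf₂ fun T ⟨hT, hTa, hTh⟩ => EReal.le_of_forall_lt_iff_le.1 fun b hb => ?_
  rw [EReal.coe_lt_coe_iff] at hb
  obtain ⟨φ, hφ, hφμ⟩ := exists_continuousMap_lt_integral hf hT hTa μ (sub_pos.2 hb)
  have hpress : topPressure f (-φ : C(X, ℝ)) ≤ 0 := by
    refine topPressure_le_of_forall hf _ fun ν hν => ?_
    refine (add_le_add_left (hTh ⟨ν, hν⟩) _).trans ?_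
    simp only [ContinuousMap.neg_apply, integral_neg]
    rw [← EReal.coe_add]
    have := hφ ⟨ν, hν⟩
    exact EReal.coe_nonpos.2 (by dsimp only at this; linarith)
  refine (hEntropy_le μ.1 (-φ)).trans ((EReal.sub_le_sub hpress le_rfl).trans ?_)
  simp only [ContinuousMap.neg_apply, integral_neg]
  rw [zero_sub, ← EReal.coe_neg, EReal.coe_le_coe_iff]
  linarith

/-- Each `ν ↦ P(φ) - ∫ φ dν` is continuous, affine and above the metric entropy, so it competes in
the envelope. -/
theorem entropyEnvelope_le_hEntropy (hf : Continuous f) {P : C(X, ℝ) → ℝ}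
    (hP : ∀ φ : C(X, ℝ), topPressure f φ = P φ) (μ : invariantMeasures f) :
    entropyEnvelope f μ ≤ hEntropy f μ.1 := by
  refine le_iInf fun φ => ?_
  rw [hP, ← EReal.coe_sub]
  refine iInf₂_le (fun ν : invariantMeasures f => P φ - ∫ x, φ x ∂(ν.1 : Measure X)) ⟨?_, ?_, ?_⟩
  · exact continuous_const.sub
      ((ProbabilityMeasure.continuous_integral_continuousMap φ).comp continuous_subtype_val)
  · intro ν₁ ν₂ ρ p hp hp1 h
    dsimp only
    rw [integral_convexCombination hp (sub_nonneg.2 hp1) h φ]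
    ring
  · intro ν
    refine (metricEntropy_le_hEntropy hf ν.2).trans ((hEntropy_le ν.1 φ).trans ?_)
    rw [hP, ← EReal.coe_sub]

end Envelope

end ThermoFormalism

/-! ### The main theorem -/

theorem mainTheorem2 {X : Type*} [MetricSpace X] [CompactSpace X] [Nonempty X]
    [MeasurableSpace X] [BorelSpace X] (f : X → X) (hf : Continuous f)
    (htop : Dynamics.coverEntropy f Set.univ < ⊤) :
    -- the map takes values in `[-∞, +∞)` and is upper semi-continuous
    (∀ μ : ProbabilityMeasure X, ThermoFormalism.hEntropy f μ < ⊤) ∧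
    UpperSemicontinuous (ThermoFormalism.hEntropy f : ProbabilityMeasure X → EReal) ∧
    -- (a)
    (∀ μ ∈ ThermoFormalism.invariantMeasures f,
      0 ≤ ThermoFormalism.metricEntropy f (μ : Measure X) ∧
      ThermoFormalism.metricEntropy f (μ : Measure X) ≤ ThermoFormalism.hEntropy f μ) ∧
    -- (b)
    (∀ φ : C(X, ℝ),
      IsGreatest (Set.range fun μ : ProbabilityMeasure X =>
          ThermoFormalism.hEntropy f μ + ((∫ x, φ x ∂(μ : Measure X) : ℝ) : EReal))
        (ThermoFormalism.topPressure f φ) ∧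
      IsGreatest ((fun μ : ProbabilityMeasure X =>
          ThermoFormalism.hEntropy f μ + ((∫ x, φ x ∂(μ : Measure X) : ℝ) : EReal)) ''
            ThermoFormalism.invariantMeasures f)
        (ThermoFormalism.topPressure f φ)) ∧
    -- (c)
    (∀ (φ : C(X, ℝ)) (μ : ProbabilityMeasure X),
      IsMaxOn (fun ν : ProbabilityMeasure X =>
          ThermoFormalism.hEntropy f ν + ((∫ x, φ x ∂(ν : Measure X) : ℝ) : EReal)) Set.univ μ →
      μ ∈ ThermoFormalism.invariantMeasures f) ∧
    -- (d)
    (∀ μ : ThermoFormalism.invariantMeasures f,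
      ThermoFormalism.hEntropy f μ.1 = ThermoFormalism.entropyEnvelope f μ) := by
  obtain ⟨P, hP⟩ := ThermoFormalism.exists_topPressure_eq_coe hf htop
  refine ⟨fun μ => ?_, ThermoFormalism.upperSemicontinuous_hEntropy hP,
    fun μ hμ => ⟨ThermoFormalism.metricEntropy_nonneg f _,
      ThermoFormalism.metricEntropy_le_hEntropy hf hμ⟩, fun φ => ?_, fun φ μ hμ => ?_,
    fun μ => (ThermoFormalism.hEntropy_le_entropyEnvelope hf μ).antisymm
      (ThermoFormalism.entropyEnvelope_le_hEntropy hf hP μ)⟩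
  · refine (ThermoFormalism.hEntropy_le μ 0).trans_lt ?_
    rw [hP, ← EReal.coe_sub]
    exact EReal.coe_lt_top _
  · obtain ⟨μ, hμ, h⟩ := ThermoFormalism.exists_invariant_hEntropy_add_integral_eq hf hP φ
    refine ⟨⟨⟨μ, h⟩, ?_⟩, ⟨μ, hμ, h⟩, ?_⟩
    · rintro _ ⟨ν, rfl⟩
      exact ThermoFormalism.hEntropy_add_integral_le ν φ
    · rintro _ ⟨ν, -, rfl⟩
      exact ThermoFormalism.hEntropy_add_integral_le ν φ
  -- Some measure attains the pressure, so a maximiser attains it too.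
  · obtain ⟨ν, -, h⟩ := ThermoFormalism.exists_invariant_hEntropy_add_integral_eq hf hP φ
    refine ThermoFormalism.mem_invariantMeasures_of_hEntropy_add_integral_eq hf hP
      ((ThermoFormalism.hEntropy_add_integral_le μ φ).antisymm ?_)
    rw [← h]
    exact hμ (Set.mem_univ ν)
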